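/- Let $n, p \ge 0$ and $N \ge 1$ be integers, $X \in \mathbb{R}^{n\times N}$, $Y \in \mathbb{R}^{p\times N}$ data matrices and $W_0 \in \mathbb{R}^{p\times n}$ an arbitrary deterministic initialization. Let $(\eta_t)_{t\ge 0}$ be non-negative real numbers (learning rates) and $(\sigma_t)_{t \ge 0}$ real numbers (noise levels). Let $G_0, G_1, \ldots$ be random $n\times N$ matrices whose columns $g_{i,t}$ ($1\le i\le N$, $t\ge 0$) are i.i.d. standard Gaussian vectors in $\mathbb{R}^n$, and put $X_t = X + \sigma_t G_t$. Augmented gradient descent on the loss $\frac1N\|Y - WX\|_F^2$ with additive Gaussian input noise is \[ W_{t+1} = W_t + \frac{2\eta_t}{N}\,(Y - W_tX_t)X_t^{\mathsf T}, \qquad t \ge 0 . \] Let $W_{\min} = YX^{\mathsf T}(XX^{\mathsf T})^+$, where $A^+$ is the Moore--Penrose pseudoinverse and $\|\cdot\|_F$ is the Frobenius norm. (a) Suppose that $\sigma_t^2 \to 0$ and $\eta_t \to 0$, that $\sigma_t^2$ is non-increasing, and that \[ \sum_{t=0}^\infty \eta_t\sigma_t^2 = \infty \qquad\text{and}\qquad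 \sum_{t=0}^\infty \eta_t^2\sigma_t^2 < \infty . \] Then $W_t \to W_{\min}$ in probability. (b) Suppose that $\eta_t = \Theta(t^{-x})$ and $\sigma_t^2 = \Theta(t^{-y})$ as $t\to\infty$, where $x, y > 0$, $x + y < 1$ and $2x + y > 1$. Then for every $\epsilon > 0$, \[ t^{\min\{y,\, x/2\} - \epsilon}\,\|W_t - W_{\min}\|_F \to 0 \quad\text{in probability.} \] -/

import Mathlib

open MeasureTheory ProbabilityTheory Filter Asymptotics
open scoped Topology Matrix

-- `‖·‖` on matrices is the Frobenius norm.
attribute [local instance] Matrix.frobeniusNormedAddCommGroup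

namespace GaussAug

/-- The four Penrose equations: `B` is the Moore-Penrose pseudoinverse of the real matrix `A`. -/
structure IsPseudoinverse {m n : ℕ} (A : Matrix (Fin m) (Fin n) ℝ)
    (B : Matrix (Fin n) (Fin m) ℝ) : Prop where
  mul_mul_left : A * B * A = A
  mul_mul_right : B * A * B = B
  left_symm : (A * B)ᵀ = A * B
  right_symm : (B * A)ᵀ = B * A

theorem exists_isPseudoinverse_of_isSymm {n : ℕ} (A : Matrix (Fin n) (Fin n) ℝ)
    (hA : A.IsSymm) : ∃ B, IsPseudoinverse A B ∧ B.IsSymm := by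
  have hH : A.IsHermitian := by
    rw [Matrix.IsHermitian, Matrix.conjTranspose_eq_transpose_of_trivial]
    exact hA
  obtain ⟨U, d, hU, hAU⟩ : ∃ (U : Matrix (Fin n) (Fin n) ℝ) (d : Fin n → ℝ),
      Uᵀ * U = 1 ∧ A = U * Matrix.diagonal d * Uᵀ := by
    refine ⟨hH.eigenvectorUnitary, hH.eigenvalues, ?_, ?_⟩
    · have := Unitary.coe_star_mul_self hH.eigenvectorUnitary
      simpa [Matrix.star_eq_conjTranspose,
        Matrix.conjTranspose_eq_transpose_of_trivial] using this
    · have := hH.spectral_theorem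
      rw [Unitary.conjStarAlgAut_apply] at this
      simpa [Matrix.star_eq_conjTranspose, Function.comp_def,
        Matrix.conjTranspose_eq_transpose_of_trivial] using this
  have key : ∀ a b : Fin n → ℝ, (U * Matrix.diagonal a * Uᵀ) * (U * Matrix.diagonal b * Uᵀ)
      = U * Matrix.diagonal (a * b) * Uᵀ := by
    intro a b
    calc _ = U * Matrix.diagonal a * (Uᵀ * U) * Matrix.diagonal b * Uᵀ := by
          simp only [Matrix.mul_assoc]
      _ = _ := by
          rw [hU, Matrix.mul_one, Matrix.mul_assoc U, Matrix.diagonal_mul_diagonal]; rfl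
  have symm : ∀ a : Fin n → ℝ, (U * Matrix.diagonal a * Uᵀ)ᵀ = U * Matrix.diagonal a * Uᵀ := by
    intro a
    simp [Matrix.transpose_mul, Matrix.mul_assoc]
  refine ⟨U * Matrix.diagonal d⁻¹ * Uᵀ, ⟨?_, ?_, ?_, ?_⟩, symm _⟩
  · rw [hAU, key, key]
    congr 3
    ext i
    simp
  · rw [hAU, key, key]
    congr 3
    ext i
    by_cases h : d i = 0 <;> simp [h]
  · rw [hAU, key, symm]
  · rw [hAU, key, symm]

theorem exists_isPseudoinverse {m n : ℕ} (A : Matrix (Fin m) (Fin n) ℝ) :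
    ∃ B, IsPseudoinverse A B := by
  obtain ⟨P, hP, hPs⟩ := exists_isPseudoinverse_of_isSymm (Aᵀ * A)
    (by simp [Matrix.IsSymm, Matrix.transpose_mul])
  have hPs' : Pᵀ = P := hPs
  have h0 : A - A * P * (Aᵀ * A) = 0 := by
    rw [← Matrix.conjTranspose_mul_self_eq_zero,
      Matrix.conjTranspose_eq_transpose_of_trivial]
    have h1 : Aᵀ * (A - A * P * (Aᵀ * A)) = 0 := by
      have := hP.mul_mul_left
      simp only [Matrix.mul_sub, ← Matrix.mul_assoc] at this ⊢
      rw [this, sub_self]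
    have h2 : (A - A * P * (Aᵀ * A))ᵀ = (1 - Aᵀ * A * P) * Aᵀ := by
      simp [Matrix.transpose_mul, hPs', Matrix.sub_mul, Matrix.mul_assoc]
    rw [h2, Matrix.mul_assoc, h1, Matrix.mul_zero]
  refine ⟨P * Aᵀ, ?_, ?_, ?_, ?_⟩
  · rw [sub_eq_zero] at h0
    simpa [Matrix.mul_assoc] using h0.symm
  · have := congrArg (· * Aᵀ) hP.mul_mul_right
    simpa [Matrix.mul_assoc] using this
  · simp [Matrix.transpose_mul, hPs', Matrix.mul_assoc]
  · have := hP.right_symm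
    rwa [← Matrix.mul_assoc] at this

theorem IsPseudoinverse.unique {m n : ℕ} {A : Matrix (Fin m) (Fin n) ℝ}
    {B C : Matrix (Fin n) (Fin m) ℝ} (hB : IsPseudoinverse A B) (hC : IsPseudoinverse A C) :
    B = C := by
  have h1 : A * B = A * C := by
    calc A * B = (A * B)ᵀ := hB.left_symm.symm
      _ = ((A * C) * (A * B))ᵀ := by rw [← Matrix.mul_assoc, hC.mul_mul_left]
      _ = (A * B) * (A * C) := by rw [Matrix.transpose_mul, hB.left_symm, hC.left_symm]
      _ = A * C := by rw [← Matrix.mul_assoc, hB.mul_mul_left]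
  have h2 : B * A = C * A := by
    calc B * A = (B * A)ᵀ := hB.right_symm.symm
      _ = ((B * A) * (C * A))ᵀ := by
          rw [Matrix.mul_assoc B, ← Matrix.mul_assoc A, hC.mul_mul_left]
      _ = (C * A) * (B * A) := by rw [Matrix.transpose_mul, hB.right_symm, hC.right_symm]
      _ = C * A := by rw [Matrix.mul_assoc C, ← Matrix.mul_assoc A, hB.mul_mul_left]
  calc B = B * A * B := hB.mul_mul_right.symm
    _ = C * A * B := by rw [h2]
    _ = C * (A * C) := by rw [Matrix.mul_assoc, h1]
    _ = C := by rw [← Matrix.mul_assoc, hC.mul_mul_right]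

/-- The Moore-Penrose pseudoinverse of a real matrix: the unique solution of the Penrose
equations. -/
noncomputable def pinv {m n : ℕ} (A : Matrix (Fin m) (Fin n) ℝ) : Matrix (Fin n) (Fin m) ℝ :=
  Classical.choose (exists_isPseudoinverse A)

theorem pinv_spec {m n : ℕ} (A : Matrix (Fin m) (Fin n) ℝ) : IsPseudoinverse A (pinv A) :=
  Classical.choose_spec (exists_isPseudoinverse A)

/-- `W_min = Y Xᵀ (X Xᵀ)⁺`. -/
noncomputable def wMin {n p N : ℕ} (X : Matrix (Fin n) (Fin N) ℝ)
    (Y : Matrix (Fin p) (Fin N) ℝ) : Matrix (Fin p) (Fin n) ℝ :=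
  Y * Xᵀ * pinv (X * Xᵀ)

/-- One step of gradient descent with learning rate `η` on the loss
`W ↦ (1 / N) * ‖Y - W * X‖ ^ 2` of a dataset `(X, Y)` with `N` columns; the gradient of this loss
is `-(2 / N) • ((Y - W * X) * Xᵀ)`. -/
noncomputable def gradStep {n p N : ℕ} (η : ℝ) (X : Matrix (Fin n) (Fin N) ℝ)
    (Y : Matrix (Fin p) (Fin N) ℝ) (W : Matrix (Fin p) (Fin n) ℝ) : Matrix (Fin p) (Fin n) ℝ :=
  W + (2 * η / N) • ((Y - W * X) * Xᵀ)

/-- The weights `W_t` of augmented gradient descent started at `W₀`: at time `t` the inputs `X`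
are replaced by `X_t = X + σ_t G_t`. The columns of `G t` are the noise vectors `g_{i,t}`. -/
noncomputable def weights {n p N : ℕ} (η σ : ℕ → ℝ) (X : Matrix (Fin n) (Fin N) ℝ)
    (Y : Matrix (Fin p) (Fin N) ℝ) (W₀ : Matrix (Fin p) (Fin n) ℝ)
    (G : ℕ → Matrix (Fin n) (Fin N) ℝ) : ℕ → Matrix (Fin p) (Fin n) ℝ
  | 0 => W₀
  | t + 1 => gradStep (η t) (X + σ t • G t) Y (weights η σ X Y W₀ G t)

/-- The columns of the random matrices `G 0, G 1, …` are i.i.d. standard Gaussian vectors, i.e.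
all the entries of all these matrices are independent `N(0, 1)` random variables. -/
structure IsStdGaussianNoise {Ω : Type*} [MeasurableSpace Ω] (μ : Measure Ω) {n N : ℕ}
    (G : ℕ → Ω → Matrix (Fin n) (Fin N) ℝ) : Prop where
  measurable : ∀ t k i, Measurable fun ω => G t ω k i
  indep : iIndepFun (fun (q : ℕ × Fin n × Fin N) ω => G q.1 ω q.2.1 q.2.2) μ
  law : ∀ t k i, HasLaw (fun ω => G t ω k i) (gaussianReal 0 1) μ

end GaussAug

/-! Split the error as `W_t - W_min = (W_t - M_t) + (M_t - W_min)`, where `M_t` is the deterministic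
recursion `meanWeights` driven by the means of `X_t X_tᵀ` and `Y X_tᵀ`. On average the noise acts as
a ridge penalty of size `σ_t²`.

Bias. By the normal equations, one step multiplies `M_t - W_min` by `1 - 2 η_t σ_t²`, subtracts its
product with `(2 η_t / N) X Xᵀ`, and adds a drift `-2 η_t σ_t² W_min`. On the range of `X Xᵀ` the
Gram term contracts at a rate of order `η_t`, so the drift only sustains an error of order `σ_t²`.
On the orthogonal complement the drift vanishes because the rows of `W_min` lie in the range, and
the ridge alone contracts, at the non-summable rate `2 η_t σ_t²`.

Variance. `W_t` depends only on noise before time `t`, so the centred fluctuation at time `t` is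
orthogonal to the past in mean square. Hence `v_t = E‖W_t - M_t‖²` contracts at a rate of order `η_t
σ_t²` while receiving a term of order `η_t² σ_t² (1 + v_t)`, and it settles at a level of order
`η_t`.

Both parts reduce to the scalar recursion `a_{t+1} ≤ (1 - b_t) a_t + b_t s_t` of
`tendsto_weighted_zero_of_contraction`, where weights `r_t` may be carried along if they grow slowly
compared with `b_t`. The bias requires `r σ² → 0` and the variance `r² η → 0`, which is the source
of the exponent `min {y, x/2}`. Markov's inequality in `tendstoInMeasure_weighted` combines them;
(a) is `r = 1` and (b) is `r_t = t^γ`. -/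

namespace GaussAug

/-! ### Scalar recursions -/

/-- A non-negative sequence that contracts at non-summable rate `b` towards a vanishing level `s`
tends to zero. -/
theorem tendsto_zero_of_contraction {a b s : ℕ → ℝ} (ha : ∀ t, 0 ≤ a t)
    (hb : ∀ᶠ t in atTop, 0 ≤ b t ∧ b t ≤ 1) (hs : Tendsto s atTop (𝓝 0)) (hdiv : ¬ Summable b)
    (h : ∀ᶠ t in atTop, a (t + 1) ≤ (1 - b t) * a t + b t * s t) :
    Tendsto a atTop (𝓝 0) := by
  refine (tendsto_order.2 ⟨fun l hl => .of_forall fun t => hl.trans_le (ha t), fun u hu => ?_⟩)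
  have hs' : ∀ᶠ t in atTop, s t ≤ u / 2 := hs.eventually_le_const (by linarith)
  obtain ⟨T, hT⟩ := eventually_atTop.1 (hb.and (h.and hs'))
  have hdiv' : Tendsto (fun k => ∑ i ∈ Finset.range k, b (i + T)) atTop atTop := by
    rw [← not_summable_iff_tendsto_nat_atTop_of_nonneg fun i => (hT (i + T) (by omega)).1.1]
    rwa [summable_nat_add_iff T]
  -- Once `s ≤ u / 2`, the excess over `u / 2` is multiplied by at most `1 - b ≤ exp (-b)`. The
  -- bound uses `a T` rather than `a T - u / 2` so that the right side is non-negative.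
  have key : ∀ k, a (k + T) - u / 2 ≤ Real.exp (-∑ i ∈ Finset.range k, b (i + T)) * a T := by
    intro k
    induction k with
    | zero => simp; linarith
    | succ k ih =>
      obtain ⟨⟨h0, h1⟩, h2, h3⟩ := hT (k + T) (by omega)
      have hexp := Real.add_one_le_exp (-b (k + T))
      have hnn : 0 ≤ Real.exp (-∑ i ∈ Finset.range k, b (i + T)) * a T :=
        mul_nonneg (Real.exp_pos _).le (ha T)
      rw [Finset.sum_range_succ, neg_add, Real.exp_add, show k + 1 + T = k + T + 1 by omega]
      calc a (k + T + 1) - u / 2 ≤ (1 - b (k + T)) * (a (k + T) - u / 2) := by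
            nlinarith [mul_le_mul_of_nonneg_left h3 h0]
        _ ≤ (1 - b (k + T)) * (Real.exp (-∑ i ∈ Finset.range k, b (i + T)) * a T) :=
            mul_le_mul_of_nonneg_left ih (by linarith)
        _ ≤ Real.exp (-b (k + T)) * (Real.exp (-∑ i ∈ Finset.range k, b (i + T)) * a T) :=
            mul_le_mul_of_nonneg_right (by linarith) hnn
        _ = _ := by ring
  have hlim : Tendsto (fun k => Real.exp (-∑ i ∈ Finset.range k, b (i + T)) * a T) atTop
      (𝓝 0) := by
    simpa using (Real.tendsto_exp_neg_atTop_nhds_zero.comp hdiv').mul_const (a T)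
  have hev : ∀ᶠ k in atTop, a (k + T) < u := by
    filter_upwards [hlim.eventually_lt_const (show (0 : ℝ) < u / 2 by linarith)] with k hk
    linarith [key k]
  obtain ⟨K, hK⟩ := eventually_atTop.1 hev
  filter_upwards [eventually_ge_atTop (K + T)] with t ht
  have := hK (t - T) (by omega)
  rwa [Nat.sub_add_cancel (by omega)] at this

/-- The weighted form of `tendsto_zero_of_contraction`: the weights may grow at half the rate of
contraction. -/
theorem tendsto_weighted_zero_of_contraction {a b s r : ℕ → ℝ} (ha : ∀ t, 0 ≤ a t)
    (hr : ∀ t, 0 ≤ r t) (hb : ∀ᶠ t in atTop, 0 ≤ b t ∧ b t ≤ 1)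
    (hs : ∀ᶠ t in atTop, 0 ≤ s t) (hrs : Tendsto (fun t => r t * s t) atTop (𝓝 0))
    (hdiv : ¬ Summable b)
    (hgrow : ∀ᶠ t in atTop, r (t + 1) ≤ (1 + b t / 2) * r t)
    (h : ∀ᶠ t in atTop, a (t + 1) ≤ (1 - b t) * a t + b t * s t) :
    Tendsto (fun t => r t * a t) atTop (𝓝 0) := by
  -- Half of the contraction pays for the growth of `r`: `(1 + b/2)(1 - b) ≤ 1 - b/2`. The factor 4
  -- comes from `(1 + b/2) b ≤ 2 b = 4 (b/2)`.
  refine tendsto_zero_of_contraction (b := fun t => b t / 2) (s := fun t => 4 * (r t * s t))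
    (fun t => mul_nonneg (hr t) (ha t)) ?_ (by simpa using hrs.const_mul 4) ?_ ?_
  · filter_upwards [hb] with t ht
    constructor <;> linarith
  · intro hsum
    exact hdiv (by simpa using hsum.mul_right 2)
  · filter_upwards [hb, hs, hgrow, h] with t ⟨hb0, hb1⟩ hs ht hat
    have hra : 0 ≤ r t * a t := mul_nonneg (hr t) (ha t)
    have hrs0 : 0 ≤ r t * s t := mul_nonneg (hr t) hs
    have hlevel : 0 ≤ (1 - b t) * a t + b t * s t :=
      add_nonneg (mul_nonneg (by linarith) (ha t)) (mul_nonneg hb0 hs)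
    have hrate : (1 + b t / 2) * (1 - b t) ≤ 1 - b t / 2 := by nlinarith
    have hforce : (1 + b t / 2) * b t ≤ b t / 2 * 4 := by nlinarith
    calc r (t + 1) * a (t + 1) ≤ r (t + 1) * ((1 - b t) * a t + b t * s t) :=
          mul_le_mul_of_nonneg_left hat (hr _)
      _ ≤ ((1 + b t / 2) * r t) * ((1 - b t) * a t + b t * s t) :=
          mul_le_mul_of_nonneg_right ht hlevel
      _ = (1 + b t / 2) * (1 - b t) * (r t * a t) + (1 + b t / 2) * b t * (r t * s t) := by ring
      _ ≤ (1 - b t / 2) * (r t * a t) + b t / 2 * 4 * (r t * s t) :=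
          add_le_add (mul_le_mul_of_nonneg_right hrate hra)
            (mul_le_mul_of_nonneg_right hforce hrs0)
      _ = _ := by ring

end GaussAug

section FrobeniusNorm

attribute [local instance] Matrix.frobeniusNormedSpace

namespace GaussAug

/-! ### The Frobenius norm and the contraction of the expected step -/

theorem frobenius_sq {m n : ℕ} (A : Matrix (Fin m) (Fin n) ℝ) :
    ‖A‖ ^ 2 = ∑ i, ∑ j, A i j ^ 2 := by
  rw [Matrix.frobenius_norm_def, ← Real.sqrt_eq_rpow, Real.sq_sqrt]
  · simp
  · positivity

theorem sum_mul_eq_trace {m n : ℕ} (A B : Matrix (Fin m) (Fin n) ℝ) :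
    ∑ i, ∑ j, A i j * B i j = (A * Bᵀ).trace := by
  simp [Matrix.trace, Matrix.mul_apply]

theorem frobenius_sq_eq_trace {m n : ℕ} (A : Matrix (Fin m) (Fin n) ℝ) :
    ‖A‖ ^ 2 = (A * Aᵀ).trace := by
  rw [frobenius_sq, ← sum_mul_eq_trace]
  simp only [sq]

theorem frobenius_add_sq {m n : ℕ} (A B : Matrix (Fin m) (Fin n) ℝ) :
    ‖A + B‖ ^ 2 = ‖A‖ ^ 2 + 2 * (∑ i, ∑ j, A i j * B i j) + ‖B‖ ^ 2 := by
  simp only [frobenius_sq, Matrix.add_apply, add_sq, Finset.sum_add_distrib, Finset.mul_sum,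
    mul_assoc]

theorem norm_add_sq_le_two_mul {E : Type*} [SeminormedAddCommGroup E] (a b : E) :
    ‖a + b‖ ^ 2 ≤ 2 * ‖a‖ ^ 2 + 2 * ‖b‖ ^ 2 := by
  have h := pow_le_pow_left₀ (norm_nonneg _) (norm_add_le a b) 2
  nlinarith [sq_nonneg (‖a‖ - ‖b‖)]

theorem norm_sub_sq_le_two_mul {E : Type*} [SeminormedAddCommGroup E] (a b : E) :
    ‖a - b‖ ^ 2 ≤ 2 * ‖a‖ ^ 2 + 2 * ‖b‖ ^ 2 := by
  simpa [sub_eq_add_neg] using norm_add_sq_le_two_mul a (-b)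

theorem frobenius_mul_sq_le {l m n : ℕ} (A : Matrix (Fin l) (Fin m) ℝ)
    (B : Matrix (Fin m) (Fin n) ℝ) : ‖A * B‖ ^ 2 ≤ ‖A‖ ^ 2 * ‖B‖ ^ 2 := by
  rw [← mul_pow]
  exact pow_le_pow_left₀ (norm_nonneg _) (Matrix.frobenius_norm_mul A B) 2

/-- Expand the square: the cross term is the trace `-2 a c ‖Z X‖²`, and `Z X Xᵀ = (Z X) Xᵀ` bounds
the quadratic term by `c² ‖Z X‖² ‖X‖²`. Keeping `‖Z X‖²` leaves room for a gain where `X Xᵀ` is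
bounded below. -/
theorem frobenius_shrink_sq_le {p n N : ℕ} (X : Matrix (Fin n) (Fin N) ℝ)
    (Z : Matrix (Fin p) (Fin n) ℝ) (a c : ℝ) :
    ‖a • Z - c • (Z * (X * Xᵀ))‖ ^ 2
      ≤ a ^ 2 * ‖Z‖ ^ 2 - c * (2 * a - c * ‖X‖ ^ 2) * ‖Z * X‖ ^ 2 := by
  have hcross : ∑ i, ∑ j, (a • Z) i j * (-(c • (Z * X * Xᵀ))) i j = -(a * c * ‖Z * X‖ ^ 2) := by
    rw [sum_mul_eq_trace, frobenius_sq_eq_trace]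
    simp only [Matrix.transpose_neg, Matrix.transpose_smul, Matrix.transpose_mul,
      Matrix.transpose_transpose, Matrix.mul_neg, Matrix.mul_smul, Matrix.smul_mul,
      Matrix.trace_neg, Matrix.trace_smul, smul_eq_mul, Matrix.mul_assoc]
    ring
  have hlast : ‖c • (Z * X * Xᵀ)‖ ^ 2 ≤ c ^ 2 * (‖Z * X‖ ^ 2 * ‖X‖ ^ 2) := by
    rw [norm_smul, mul_pow, Real.norm_eq_abs, sq_abs]
    refine mul_le_mul_of_nonneg_left ?_ (sq_nonneg c)
    simpa [Matrix.frobenius_norm_transpose] using frobenius_mul_sq_le (Z * X) Xᵀ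
  rw [← Matrix.mul_assoc, sub_eq_add_neg, frobenius_add_sq, hcross, norm_neg, norm_smul, mul_pow,
    Real.norm_eq_abs, sq_abs]
  linarith

theorem frobenius_shrink_le {p n N : ℕ} (X : Matrix (Fin n) (Fin N) ℝ)
    (Z : Matrix (Fin p) (Fin n) ℝ) {a c : ℝ} (ha : 0 ≤ a) (hc : 0 ≤ c)
    (hcX : c * ‖X‖ ^ 2 ≤ 2 * a) :
    ‖a • Z - c • (Z * (X * Xᵀ))‖ ≤ a * ‖Z‖ := by
  refine le_of_sq_le_sq ?_ (by positivity)
  refine (frobenius_shrink_sq_le X Z a c).trans ?_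
  have : 0 ≤ c * (2 * a - c * ‖X‖ ^ 2) * ‖Z * X‖ ^ 2 :=
    mul_nonneg (mul_nonneg hc (by linarith)) (sq_nonneg _)
  rw [mul_pow]
  linarith

/-- If the rows of `Z` lie in a subspace on which `X Xᵀ` is bounded below, the expected step
contracts `Z` at a rate proportional to the step size. -/
theorem frobenius_shrink_range_le {p n N : ℕ} (X : Matrix (Fin n) (Fin N) ℝ)
    (Z : Matrix (Fin p) (Fin n) ℝ) {a c K : ℝ} (ha : a ≤ 1) (ha' : 1 / 2 ≤ a) (hc : 0 ≤ c)
    (hcX : c * ‖X‖ ^ 2 ≤ 1 / 2) (hK : 0 < K) (hcK : c ≤ 4 * K) (hZ : ‖Z‖ ^ 2 ≤ K * ‖Z * X‖ ^ 2) :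
    ‖a • Z - c • (Z * (X * Xᵀ))‖ ≤ (1 - c / (4 * K)) * ‖Z‖ := by
  have hcK1 : c / (4 * K) ≤ 1 := by rw [div_le_one (by positivity)]; exact hcK
  refine le_of_sq_le_sq ?_ (mul_nonneg (by linarith) (norm_nonneg _))
  refine (frobenius_shrink_sq_le X Z a c).trans ?_
  -- The hypotheses give `2 a - c ‖X‖² ≥ 1/2`. The resulting loss `c / (2 K)` is twice `c / (4 K)`,
  -- the linear part of `1 - (1 - c / (4 K))²`.
  have h1 : c / (2 * K) * ‖Z‖ ^ 2 ≤ c * (2 * a - c * ‖X‖ ^ 2) * ‖Z * X‖ ^ 2 := by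
    calc c / (2 * K) * ‖Z‖ ^ 2 ≤ c / (2 * K) * (K * ‖Z * X‖ ^ 2) :=
          mul_le_mul_of_nonneg_left hZ (by positivity)
      _ = c * (1 / 2) * ‖Z * X‖ ^ 2 := by field_simp
      _ ≤ c * (2 * a - c * ‖X‖ ^ 2) * ‖Z * X‖ ^ 2 := by
          gcongr
          linarith
  have h2 : a ^ 2 * ‖Z‖ ^ 2 ≤ ‖Z‖ ^ 2 := by
    have : a ^ 2 ≤ 1 := by nlinarith
    nlinarith [sq_nonneg ‖Z‖]
  have h3 : c / (2 * K) = 2 * (c / (4 * K)) := by field_simp; norm_num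
  rw [h3] at h1
  nlinarith [mul_nonneg (sq_nonneg (c / (4 * K))) (sq_nonneg ‖Z‖)]

end GaussAug

end FrobeniusNorm

section MeanDynamics

attribute [local instance] Matrix.frobeniusNormedSpace

namespace GaussAug

/-! ### The expected dynamics -/

/-- The expected weights: gradient descent with `X_t X_tᵀ` and `Y X_tᵀ` replaced by their
means. -/
noncomputable def meanWeights {n p N : ℕ} (η σ : ℕ → ℝ) (X : Matrix (Fin n) (Fin N) ℝ)
    (Y : Matrix (Fin p) (Fin N) ℝ) (W₀ : Matrix (Fin p) (Fin n) ℝ) :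
    ℕ → Matrix (Fin p) (Fin n) ℝ
  | 0 => W₀
  | t + 1 => meanWeights η σ X Y W₀ t + (2 * η t / N) •
      (Y * Xᵀ - meanWeights η σ X Y W₀ t * (X * Xᵀ + (N * σ t ^ 2) • 1))

theorem pinv_isSymm {n : ℕ} {S : Matrix (Fin n) (Fin n) ℝ} (hS : S.IsSymm) :
    (pinv S)ᵀ = pinv S := by
  obtain ⟨B, hB, hBs⟩ := exists_isPseudoinverse_of_isSymm S hS
  rw [(pinv_spec S).unique hB]
  exact hBs

theorem mul_pinv_comm {n : ℕ} {S : Matrix (Fin n) (Fin n) ℝ} (hS : S.IsSymm) :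
    S * pinv S = pinv S * S := by
  rw [← (pinv_spec S).left_symm, Matrix.transpose_mul, pinv_isSymm hS, hS.eq]

/-- The projection `S S⁺` onto the range of `S = X Xᵀ` fixes `X`. -/
theorem gram_mul_pinv_mul_self {n N : ℕ} (X : Matrix (Fin n) (Fin N) ℝ) :
    X * Xᵀ * pinv (X * Xᵀ) * X = X := by
  set S := X * Xᵀ with hSdef
  have h1 : S * pinv S * S = S := (pinv_spec S).mul_mul_left
  have h2 : (S * pinv S)ᵀ = S * pinv S := (pinv_spec S).left_symm
  -- `A = S S⁺ X - X` satisfies `A Xᵀ = S S⁺ S - S = 0`, hence `A Aᵀ = 0`.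
  have h0 : S * pinv S * X - X = 0 := by
    rw [← Matrix.self_mul_conjTranspose_eq_zero, Matrix.conjTranspose_eq_transpose_of_trivial]
    have h3 : (S * pinv S * X - X) * Xᵀ = 0 := by
      rw [Matrix.sub_mul, Matrix.mul_assoc _ X, ← hSdef, h1, sub_self]
    rw [Matrix.transpose_sub, Matrix.transpose_mul, h2, Matrix.mul_sub, h3,
      ← Matrix.mul_assoc, h3]
    simp
  exact sub_eq_zero.1 h0

theorem transpose_mul_gram_mul_pinv {n N : ℕ} (X : Matrix (Fin n) (Fin N) ℝ) :
    Xᵀ * (X * Xᵀ * pinv (X * Xᵀ)) = Xᵀ := by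
  have h := congrArg Matrix.transpose (gram_mul_pinv_mul_self X)
  rwa [Matrix.transpose_mul, (pinv_spec (X * Xᵀ)).left_symm] at h

/-- These are the normal equations of the noiseless problem; they hold because `S S⁺` is symmetric,
commutes with itself reversed to `S⁺ S`, and fixes `X`. -/
theorem wMin_mul_gram {n p N : ℕ} (X : Matrix (Fin n) (Fin N) ℝ) (Y : Matrix (Fin p) (Fin N) ℝ) :
    wMin X Y * (X * Xᵀ) = Y * Xᵀ := by
  rw [wMin, Matrix.mul_assoc, ← mul_pinv_comm (S := X * Xᵀ)
    (by simp [Matrix.IsSymm, Matrix.transpose_mul]),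
    Matrix.mul_assoc Y, transpose_mul_gram_mul_pinv]

/-- Having its rows in the range of `X Xᵀ` singles out `W_min` among the solutions of the normal
equations, and removes the drift on the orthogonal complement. -/
theorem wMin_mul_proj {n p N : ℕ} (X : Matrix (Fin n) (Fin N) ℝ) (Y : Matrix (Fin p) (Fin N) ℝ) :
    wMin X Y * (X * Xᵀ * pinv (X * Xᵀ)) = wMin X Y := by
  rw [← Matrix.mul_assoc, wMin_mul_gram, wMin]

/-- The normal equations cancel `Y Xᵀ`. The ridge term then acts on `M_t = (M_t - W_min) + W_min`,
giving a shrinkage of the error and a drift along `W_min`. -/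
theorem meanWeights_succ_sub {n p N : ℕ} (hN : 0 < N) (η σ : ℕ → ℝ)
    (X : Matrix (Fin n) (Fin N) ℝ) (Y : Matrix (Fin p) (Fin N) ℝ)
    (W₀ : Matrix (Fin p) (Fin n) ℝ) (t : ℕ) :
    meanWeights η σ X Y W₀ (t + 1) - wMin X Y =
      (1 - 2 * (η t * σ t ^ 2)) • (meanWeights η σ X Y W₀ t - wMin X Y)
      - (2 * η t / N) • ((meanWeights η σ X Y W₀ t - wMin X Y) * (X * Xᵀ))
      - (2 * (η t * σ t ^ 2)) • wMin X Y := by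
  have hN' : (N : ℝ) ≠ 0 := by positivity
  have h : 2 * η t / N * (N * σ t ^ 2) = 2 * (η t * σ t ^ 2) := by field_simp
  rw [meanWeights, ← wMin_mul_gram, Matrix.mul_add, Matrix.mul_smul, Matrix.mul_one, Matrix.sub_mul,
    ← h]
  module

variable {n p N : ℕ} {η σ r : ℕ → ℝ}

theorem not_summable_of_mul_sq (hη : ∀ t, 0 ≤ η t)
    (hσ : Tendsto (fun t => σ t ^ 2) atTop (𝓝 0)) (hdiv : ¬ Summable fun t => η t * σ t ^ 2) :
    ¬ Summable η := by
  intro h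
  refine hdiv (h.of_norm_bounded_eventually_nat ?_)
  filter_upwards [hσ.eventually_le_const zero_lt_one] with t ht
  rw [Real.norm_of_nonneg (mul_nonneg (hη t) (sq_nonneg _))]
  exact mul_le_of_le_one_right (hη t) ht

theorem eventually_step_small (hη0 : Tendsto η atTop (𝓝 0))
    (hσ : Tendsto (fun t => σ t ^ 2) atTop (𝓝 0)) (C : ℝ) {δ : ℝ} (hδ : 0 < δ) :
    ∀ᶠ t in atTop, η t * σ t ^ 2 ≤ δ ∧ η t * C ≤ δ ∧ σ t ^ 2 ≤ 1 := by
  have h1 : Tendsto (fun t => η t * σ t ^ 2) atTop (𝓝 0) := by simpa using hη0.mul hσ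
  have h2 : Tendsto (fun t => η t * C) atTop (𝓝 0) := by simpa using hη0.mul_const C
  filter_upwards [h1.eventually_le_const hδ, h2.eventually_le_const hδ,
    hσ.eventually_le_const zero_lt_one] with t h1 h2 h3 using ⟨h1, h2, h3⟩

/-- The part of the mean error in the range of `X Xᵀ`. -/
theorem tendsto_meanWeights_range (hN : 0 < N) (X : Matrix (Fin n) (Fin N) ℝ)
    (Y : Matrix (Fin p) (Fin N) ℝ) (W₀ : Matrix (Fin p) (Fin n) ℝ) (hη : ∀ t, 0 ≤ η t)
    (hη0 : Tendsto η atTop (𝓝 0)) (hσ : Tendsto (fun t => σ t ^ 2) atTop (𝓝 0))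
    (hdiv : ¬ Summable fun t => η t * σ t ^ 2) (hr : ∀ t, 0 ≤ r t)
    (hgrow : ∀ θ > 0, ∀ᶠ t in atTop, r (t + 1) ≤ (1 + θ * (η t * σ t ^ 2)) * r t)
    (hrσ : Tendsto (fun t => r t * σ t ^ 2) atTop (𝓝 0)) :
    Tendsto (fun t => r t *
      ‖(meanWeights η σ X Y W₀ t - wMin X Y) * (X * Xᵀ * pinv (X * Xᵀ))‖) atTop (𝓝 0) := by
  set P := X * Xᵀ * pinv (X * Xᵀ) with hP
  -- `Z P = (Z X)(Xᵀ S⁺)` makes `1 / K` a lower bound for `X Xᵀ` on its range, without eigenvalues.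
  -- The `+ 1` keeps `K` positive when `X = 0`.
  set K : ℝ := ‖Xᵀ * pinv (X * Xᵀ)‖ ^ 2 + 1
  have hK : 0 < K := by positivity
  have hNpos : (0 : ℝ) < N := by positivity
  have hPS : P * (X * Xᵀ) = X * Xᵀ * P := by
    rw [hP, (pinv_spec _).mul_mul_left, Matrix.mul_assoc X, transpose_mul_gram_mul_pinv]
  have hlow : ∀ Z : Matrix (Fin p) (Fin n) ℝ, ‖Z * P‖ ^ 2 ≤ K * ‖Z * P * X‖ ^ 2 := by
    intro Z
    have h1 : Z * P * X = Z * X := by rw [Matrix.mul_assoc, hP, gram_mul_pinv_mul_self]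
    have h2 : Z * P = Z * X * (Xᵀ * pinv (X * Xᵀ)) := by simp only [hP, Matrix.mul_assoc]
    rw [h1, h2]
    refine (frobenius_mul_sq_le _ _).trans ?_
    nlinarith [sq_nonneg ‖Z * X‖]
  -- The rate is `c / (4 K)` for the step `c = 2 η / N`, and the level is chosen so that `b s = 2 η
  -- σ² ‖W_min‖`, the size of the drift.
  refine tendsto_weighted_zero_of_contraction (b := fun t => η t / (2 * N * K))
    (s := fun t => 4 * K * N * σ t ^ 2 * ‖wMin X Y‖)
    (fun t => norm_nonneg _) hr ?_ (.of_forall fun t => by positivity) ?_ ?_ ?_ ?_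
  · filter_upwards [hη0.eventually_le_const (show 0 < 2 * N * K by positivity)] with t ht
    exact ⟨div_nonneg (hη t) (by positivity), by rwa [div_le_one (by positivity)]⟩
  · have := hrσ.const_mul (4 * K * N * ‖wMin X Y‖)
    rw [mul_zero] at this
    exact this.congr fun t => by ring
  · intro h
    refine not_summable_of_mul_sq hη hσ hdiv ((h.mul_right (2 * N * K)).congr fun t => ?_)
    field_simp
  · filter_upwards [hgrow (1 / (4 * N * K)) (by positivity),
      hσ.eventually_le_const zero_lt_one] with t ht hσt
    refine ht.trans (mul_le_mul_of_nonneg_right ?_ (hr t))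
    have : η t * σ t ^ 2 ≤ η t := mul_le_of_le_one_right (hη t) hσt
    calc 1 + 1 / (4 * N * K) * (η t * σ t ^ 2) ≤ 1 + 1 / (4 * N * K) * η t := by gcongr
      _ = 1 + η t / (2 * N * K) / 2 := by field_simp; ring
  · filter_upwards [eventually_step_small hη0 hσ (2 / N * ‖X‖ ^ 2)
        (show (0 : ℝ) < 1 / 4 by norm_num),
      hη0.eventually_le_const (show 0 < 2 * N * K by positivity)] with t ⟨h1, h2, _⟩ h3
    have hησ : 0 ≤ η t * σ t ^ 2 := mul_nonneg (hη t) (sq_nonneg _)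
    have hrec : (meanWeights η σ X Y W₀ (t + 1) - wMin X Y) * P =
        (1 - 2 * (η t * σ t ^ 2)) • ((meanWeights η σ X Y W₀ t - wMin X Y) * P)
        - (2 * η t / N) • ((meanWeights η σ X Y W₀ t - wMin X Y) * P * (X * Xᵀ))
        - (2 * (η t * σ t ^ 2)) • wMin X Y := by
      rw [meanWeights_succ_sub hN, Matrix.sub_mul, Matrix.sub_mul, Matrix.smul_mul,
        Matrix.smul_mul, Matrix.smul_mul, wMin_mul_proj, Matrix.mul_assoc _ P, hPS,
        Matrix.mul_assoc _ (X * Xᵀ)]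
    rw [hrec]
    refine (norm_sub_le _ _).trans (add_le_add ?_ ?_)
    · have := frobenius_shrink_range_le X ((meanWeights η σ X Y W₀ t - wMin X Y) * P)
        (a := 1 - 2 * (η t * σ t ^ 2)) (c := 2 * η t / N) (K := K)
        (by linarith) (by linarith) (div_nonneg (by linarith [hη t]) hNpos.le)
        (by
          have : 2 * η t / N * ‖X‖ ^ 2 = η t * (2 / N * ‖X‖ ^ 2) := by ring
          linarith) hK
        (by rw [div_le_iff₀ hNpos]; linarith) (hlow _)
      refine this.trans (le_of_eq ?_)
      congr 2
      field_simp
      ring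
    · rw [norm_smul, Real.norm_of_nonneg (by positivity)]
      refine le_of_eq ?_
      field_simp
      ring

/-- The part of the mean error orthogonal to the range of `X Xᵀ`. -/
theorem tendsto_meanWeights_ker (hN : 0 < N) (X : Matrix (Fin n) (Fin N) ℝ)
    (Y : Matrix (Fin p) (Fin N) ℝ) (W₀ : Matrix (Fin p) (Fin n) ℝ) (hη : ∀ t, 0 ≤ η t)
    (hη0 : Tendsto η atTop (𝓝 0)) (hσ : Tendsto (fun t => σ t ^ 2) atTop (𝓝 0))
    (hdiv : ¬ Summable fun t => η t * σ t ^ 2) (hr : ∀ t, 0 ≤ r t)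
    (hgrow : ∀ θ > 0, ∀ᶠ t in atTop, r (t + 1) ≤ (1 + θ * (η t * σ t ^ 2)) * r t) :
    Tendsto (fun t => r t *
      ‖(meanWeights η σ X Y W₀ t - wMin X Y) * (1 - X * Xᵀ * pinv (X * Xᵀ))‖) atTop (𝓝 0) := by
  set Q := 1 - X * Xᵀ * pinv (X * Xᵀ) with hQ
  have hSQ : X * Xᵀ * Q = 0 := by
    rw [hQ, Matrix.mul_sub, Matrix.mul_one, Matrix.mul_assoc X, transpose_mul_gram_mul_pinv,
      sub_self]
  have hWQ : wMin X Y * Q = 0 := by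
    rw [hQ, Matrix.mul_sub, Matrix.mul_one, wMin_mul_proj, sub_self]
  have hησ : ∀ t, 0 ≤ η t * σ t ^ 2 := fun t => mul_nonneg (hη t) (sq_nonneg _)
  -- `Q` annihilates both the Gram term and the drift, so only the scalar factor remains and the
  -- level is zero.
  refine tendsto_weighted_zero_of_contraction (b := fun t => 2 * (η t * σ t ^ 2))
    (s := fun _ => 0) (fun t => norm_nonneg _) hr ?_ (.of_forall fun t => le_rfl) (by simp) ?_ ?_ ?_
  · filter_upwards [eventually_step_small hη0 hσ 0 (show (0 : ℝ) < 1 / 2 by norm_num)]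
      with t ⟨h1, _, _⟩
    exact ⟨by linarith [hησ t], by linarith⟩
  · intro h
    exact hdiv ((h.mul_left (1 / 2)).congr fun t => by ring)
  · filter_upwards [hgrow 1 one_pos] with t ht
    refine ht.trans (le_of_eq ?_)
    ring
  · filter_upwards [eventually_step_small hη0 hσ 0 (show (0 : ℝ) < 1 / 2 by norm_num)]
      with t ⟨h1, _, _⟩
    rw [meanWeights_succ_sub hN, Matrix.sub_mul, Matrix.sub_mul, Matrix.smul_mul,
      Matrix.smul_mul, Matrix.smul_mul, Matrix.mul_assoc _ (X * Xᵀ), hSQ, hWQ]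
    simp only [Matrix.mul_zero, smul_zero, sub_zero, mul_zero, add_zero]
    rw [norm_smul, Real.norm_of_nonneg (by linarith)]

theorem tendsto_meanWeights (hN : 0 < N) (X : Matrix (Fin n) (Fin N) ℝ)
    (Y : Matrix (Fin p) (Fin N) ℝ) (W₀ : Matrix (Fin p) (Fin n) ℝ) (hη : ∀ t, 0 ≤ η t)
    (hη0 : Tendsto η atTop (𝓝 0)) (hσ : Tendsto (fun t => σ t ^ 2) atTop (𝓝 0))
    (hdiv : ¬ Summable fun t => η t * σ t ^ 2) (hr : ∀ t, 0 ≤ r t)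
    (hgrow : ∀ θ > 0, ∀ᶠ t in atTop, r (t + 1) ≤ (1 + θ * (η t * σ t ^ 2)) * r t)
    (hrσ : Tendsto (fun t => r t * σ t ^ 2) atTop (𝓝 0)) :
    Tendsto (fun t => r t * ‖meanWeights η σ X Y W₀ t - wMin X Y‖) atTop (𝓝 0) := by
  have h := (tendsto_meanWeights_range hN X Y W₀ hη hη0 hσ hdiv hr hgrow hrσ).add
    (tendsto_meanWeights_ker hN X Y W₀ hη hη0 hσ hdiv hr hgrow)
  rw [add_zero] at h
  refine squeeze_zero (fun t => mul_nonneg (hr t) (norm_nonneg _)) (fun t => ?_) h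
  rw [← mul_add]
  refine mul_le_mul_of_nonneg_left ?_ (hr t)
  refine le_trans (le_of_eq ?_) (norm_add_le _ _)
  rw [← Matrix.mul_add, add_sub_cancel, Matrix.mul_one]

end GaussAug

end MeanDynamics

section SecondMoment

attribute [local instance] Matrix.frobeniusNormedSpace

namespace GaussAug

/-! ### One step of the second-moment recursion -/

theorem entry_sq_le_frobenius_sq {m n : ℕ} (A : Matrix (Fin m) (Fin n) ℝ) (i : Fin m)
    (j : Fin n) : A i j ^ 2 ≤ ‖A‖ ^ 2 := by
  rw [frobenius_sq]
  exact (Finset.single_le_sum (f := fun j => A i j ^ 2) (fun _ _ => sq_nonneg _)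
    (Finset.mem_univ j)).trans (Finset.single_le_sum (f := fun i => ∑ j, A i j ^ 2)
      (fun _ _ => Finset.sum_nonneg fun _ _ => sq_nonneg _) (Finset.mem_univ i))

theorem measurable_frobenius_sq {Ω : Type*} {_ : MeasurableSpace Ω} {m n : ℕ}
    {A : Ω → Matrix (Fin m) (Fin n) ℝ} (hA : ∀ i j, Measurable fun ω => A ω i j) :
    Measurable fun ω => ‖A ω‖ ^ 2 := by
  simp only [frobenius_sq]
  exact Finset.measurable_sum _ fun i _ => Finset.measurable_sum _ fun j _ => (hA i j).pow_const 2

theorem indepFun_of_indep {Ω : Type*} {F 𝒢 mΩ : MeasurableSpace Ω} {μ : Measure Ω}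
    (h : Indep F 𝒢 μ) {f g : Ω → ℝ} (hf : Measurable[F] f) (hg : Measurable[𝒢] g) :
    IndepFun f g μ := by
  rw [IndepFun_iff_Indep]
  exact indep_of_indep_of_le_left (indep_of_indep_of_le_right h hg.comap_le) hf.comap_le

theorem integrable_mul_of_integrable_sq {Ω : Type*} {mΩ : MeasurableSpace Ω} {μ : Measure Ω}
    {f g : Ω → ℝ} (hf : Measurable f) (hg : Measurable g) (hf2 : Integrable (fun ω => f ω ^ 2) μ)
    (hg2 : Integrable (fun ω => g ω ^ 2) μ) : Integrable (fun ω => f ω * g ω) μ :=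
  MemLp.integrable_mul ((memLp_two_iff_integrable_sq hf.aestronglyMeasurable).2 hf2)
    ((memLp_two_iff_integrable_sq hg.aestronglyMeasurable).2 hg2)

theorem integrable_entry_sq {Ω : Type*} {mΩ : MeasurableSpace Ω} {μ : Measure Ω} {m n : ℕ}
    {A : Ω → Matrix (Fin m) (Fin n) ℝ} (hA : ∀ i j, Measurable fun ω => A ω i j)
    (hA2 : Integrable (fun ω => ‖A ω‖ ^ 2) μ) (i : Fin m) (j : Fin n) :
    Integrable (fun ω => A ω i j ^ 2) μ := by
  refine hA2.mono' ((hA i j).pow_const 2).aestronglyMeasurable (ae_of_all _ fun ω => ?_)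
  rw [Real.norm_of_nonneg (sq_nonneg _)]
  exact entry_sq_le_frobenius_sq _ _ _

/-- If `V` and `W` depend on the past and `H`, `K` are centred and independent of the past, the
increment `H - W K` is orthogonal to `V` in mean square. -/
theorem second_moment_step {Ω : Type*} {F 𝒢 mΩ : MeasurableSpace Ω} {μ : Measure Ω}
    [IsProbabilityMeasure μ] (hF : F ≤ mΩ) (h𝒢 : 𝒢 ≤ mΩ) (hind : Indep F 𝒢 μ) {p n : ℕ}
    {V W H : Ω → Matrix (Fin p) (Fin n) ℝ} {K : Ω → Matrix (Fin n) (Fin n) ℝ}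
    (hV : ∀ i j, Measurable[F] fun ω => V ω i j) (hW : ∀ i j, Measurable[F] fun ω => W ω i j)
    (hH : ∀ i j, Measurable[𝒢] fun ω => H ω i j) (hK : ∀ i j, Measurable[𝒢] fun ω => K ω i j)
    (hV2 : Integrable (fun ω => ‖V ω‖ ^ 2) μ) (hW2 : Integrable (fun ω => ‖W ω‖ ^ 2) μ)
    (hH2 : Integrable (fun ω => ‖H ω‖ ^ 2) μ) (hK2 : Integrable (fun ω => ‖K ω‖ ^ 2) μ)
    (hH0 : ∀ i j, ∫ ω, H ω i j ∂μ = 0) (hK0 : ∀ i j, ∫ ω, K ω i j ∂μ = 0) (c : ℝ) :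
    Integrable (fun ω => ‖V ω + c • (H ω - W ω * K ω)‖ ^ 2) μ ∧
    ∫ ω, ‖V ω + c • (H ω - W ω * K ω)‖ ^ 2 ∂μ ≤ ∫ ω, ‖V ω‖ ^ 2 ∂μ +
      c ^ 2 * (2 * ∫ ω, ‖H ω‖ ^ 2 ∂μ + 2 * ((∫ ω, ‖W ω‖ ^ 2 ∂μ) * ∫ ω, ‖K ω‖ ^ 2 ∂μ)) := by
  have hVm := fun i j => (hV i j).mono hF le_rfl
  have hWm := fun i j => (hW i j).mono hF le_rfl
  have hHm := fun i j => (hH i j).mono h𝒢 le_rfl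
  have hKm := fun i j => (hK i j).mono h𝒢 le_rfl
  have hξm : ∀ i j, Measurable fun ω => (H ω - W ω * K ω) i j := by
    intro i j
    simp only [Matrix.sub_apply, Matrix.mul_apply]
    exact (hHm i j).sub (Finset.measurable_sum _ fun k _ => (hWm i k).mul (hKm k j))
  have hWK := indepFun_of_indep hind (measurable_frobenius_sq hW) (measurable_frobenius_sq hK)
  -- A product of two integrable functions need not be integrable; independence of `W` and `K`
  -- provides it.
  have hWK2 : Integrable (fun ω => ‖W ω‖ ^ 2 * ‖K ω‖ ^ 2) μ := hWK.integrable_mul hW2 hK2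
  have hWKint : ∫ ω, ‖W ω‖ ^ 2 * ‖K ω‖ ^ 2 ∂μ = (∫ ω, ‖W ω‖ ^ 2 ∂μ) * ∫ ω, ‖K ω‖ ^ 2 ∂μ :=
    hWK.integral_mul_eq_mul_integral hW2.1 hK2.1
  have hbound : ∀ ω, ‖H ω - W ω * K ω‖ ^ 2 ≤ 2 * ‖H ω‖ ^ 2 + 2 * (‖W ω‖ ^ 2 * ‖K ω‖ ^ 2) :=
    fun ω => (norm_sub_sq_le_two_mul _ _).trans
      (by linarith [frobenius_mul_sq_le (W ω) (K ω)])
  have hdom : Integrable (fun ω => 2 * ‖H ω‖ ^ 2 + 2 * (‖W ω‖ ^ 2 * ‖K ω‖ ^ 2)) μ :=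
    (hH2.const_mul 2).add (hWK2.const_mul 2)
  have hξ2 : Integrable (fun ω => ‖H ω - W ω * K ω‖ ^ 2) μ := by
    refine hdom.mono' (measurable_frobenius_sq hξm).aestronglyMeasurable (ae_of_all _ fun ω => ?_)
    rw [Real.norm_of_nonneg (sq_nonneg _)]
    exact hbound ω
  have hξint : ∫ ω, ‖H ω - W ω * K ω‖ ^ 2 ∂μ ≤
      2 * ∫ ω, ‖H ω‖ ^ 2 ∂μ + 2 * ((∫ ω, ‖W ω‖ ^ 2 ∂μ) * ∫ ω, ‖K ω‖ ^ 2 ∂μ) := by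
    refine (integral_mono hξ2 hdom hbound).trans (le_of_eq ?_)
    rw [integral_add (hH2.const_mul 2) (hWK2.const_mul 2), integral_const_mul, integral_const_mul,
      hWKint]
  have hcrossint : ∀ i j, Integrable (fun ω => V ω i j * (H ω - W ω * K ω) i j) μ := fun i j =>
    integrable_mul_of_integrable_sq (hVm i j) (hξm i j) (integrable_entry_sq hVm hV2 i j)
      (integrable_entry_sq hξm hξ2 i j)
  have hcross0 : ∀ i j, ∫ ω, V ω i j * (H ω - W ω * K ω) i j ∂μ = 0 := by
    intro i j
    have hVH : Integrable (fun ω => V ω i j * H ω i j) μ :=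
      integrable_mul_of_integrable_sq (hVm i j) (hHm i j) (integrable_entry_sq hVm hV2 i j)
        (integrable_entry_sq hHm hH2 i j)
    have hVW : ∀ k, Integrable (fun ω => V ω i j * W ω i k) μ := fun k =>
      integrable_mul_of_integrable_sq (hVm i j) (hWm i k) (integrable_entry_sq hVm hV2 i j)
        (integrable_entry_sq hWm hW2 i k)
    have hK1 : ∀ k, Integrable (fun ω => K ω k j) μ := fun k =>
      ((memLp_two_iff_integrable_sq (hKm k j).aestronglyMeasurable).2
        (integrable_entry_sq hKm hK2 k j)).integrable one_le_two
    -- The past-measurable product `V W` is integrable by Cauchy–Schwarz, and is independent of the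
    -- centred factor `K`, so the expectation factors through zero.
    have hVWK := fun k => indepFun_of_indep hind ((hV i j).mul (hW i k)) (hK k j)
    have hVWKi : ∀ k, Integrable (fun ω => V ω i j * W ω i k * K ω k j) μ := fun k =>
      (hVWK k).integrable_mul (hVW k) (hK1 k)
    have hVWK0 : ∀ k, ∫ ω, V ω i j * W ω i k * K ω k j ∂μ = 0 := fun k => by
      have : ∫ ω, V ω i j * W ω i k * K ω k j ∂μ
          = (∫ ω, V ω i j * W ω i k ∂μ) * ∫ ω, K ω k j ∂μ :=
        (hVWK k).integral_mul_eq_mul_integral (hVW k).1 (hK1 k).1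
      rw [this, hK0, mul_zero]
    have hVH0 : ∫ ω, V ω i j * H ω i j ∂μ = 0 := by
      have : ∫ ω, V ω i j * H ω i j ∂μ = (∫ ω, V ω i j ∂μ) * ∫ ω, H ω i j ∂μ :=
        (indepFun_of_indep hind (hV i j) (hH i j)).integral_mul_eq_mul_integral
          (hVm i j).aestronglyMeasurable (hHm i j).aestronglyMeasurable
      rw [this, hH0, mul_zero]
    simp only [Matrix.sub_apply, Matrix.mul_apply, mul_sub, Finset.mul_sum, ← mul_assoc]
    rw [integral_sub hVH (integrable_finsetSum _ fun k _ => hVWKi k),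
      integral_finsetSum _ fun k _ => hVWKi k, hVH0]
    simp [hVWK0]
  have hexp : ∀ ω, ‖V ω + c • (H ω - W ω * K ω)‖ ^ 2 = ‖V ω‖ ^ 2
      + 2 * c * (∑ i, ∑ j, V ω i j * (H ω - W ω * K ω) i j)
      + c ^ 2 * ‖H ω - W ω * K ω‖ ^ 2 := by
    intro ω
    rw [frobenius_add_sq, norm_smul, mul_pow, Real.norm_eq_abs, sq_abs]
    simp only [Matrix.smul_apply, smul_eq_mul, Finset.mul_sum]
    congr 2
    refine Finset.sum_congr rfl fun i _ => Finset.sum_congr rfl fun j _ => by ring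
  have hsum : Integrable (fun ω => ∑ i, ∑ j, V ω i j * (H ω - W ω * K ω) i j) μ :=
    integrable_finsetSum _ fun i _ => integrable_finsetSum _ fun j _ => hcrossint i j
  have hsum0 : ∫ ω, ∑ i, ∑ j, V ω i j * (H ω - W ω * K ω) i j ∂μ = 0 := by
    rw [integral_finsetSum _ fun i _ => integrable_finsetSum _ fun j _ => hcrossint i j]
    refine Finset.sum_eq_zero fun i _ => ?_
    rw [integral_finsetSum _ fun j _ => hcrossint i j]
    exact Finset.sum_eq_zero fun j _ => hcross0 i j
  have hfirst : Integrable (fun ω => ‖V ω‖ ^ 2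
      + 2 * c * (∑ i, ∑ j, V ω i j * (H ω - W ω * K ω) i j)) μ := hV2.add (hsum.const_mul _)
  simp only [hexp]
  refine ⟨hfirst.add (hξ2.const_mul _), ?_⟩
  rw [integral_add hfirst (hξ2.const_mul _),
    integral_add hV2 (hsum.const_mul _), integral_const_mul, integral_const_mul, hsum0, mul_zero,
    add_zero]
  gcongr

end GaussAug

end SecondMoment

section Noise

attribute [local instance] Matrix.frobeniusNormedSpace

namespace GaussAug

/-! ### The Gaussian noise -/

variable {Ω : Type*} {n p N : ℕ}

/-- The σ-algebra generated by one entry of the noise. -/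
@[reducible]
def entryAlgebra (G : ℕ → Ω → Matrix (Fin n) (Fin N) ℝ) (q : ℕ × Fin n × Fin N) :
    MeasurableSpace Ω :=
  MeasurableSpace.comap (fun ω => G q.1 ω q.2.1 q.2.2) inferInstance

/-- The σ-algebra generated by the noise at the times in `S`. -/
@[reducible]
def noiseAlgebra (G : ℕ → Ω → Matrix (Fin n) (Fin N) ℝ) (S : Set ℕ) : MeasurableSpace Ω :=
  ⨆ q ∈ (Prod.fst ⁻¹' S : Set (ℕ × Fin n × Fin N)), entryAlgebra G q

theorem noiseAlgebra_mono (G : ℕ → Ω → Matrix (Fin n) (Fin N) ℝ) {S T : Set ℕ} (h : S ⊆ T) :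
    noiseAlgebra G S ≤ noiseAlgebra G T :=
  biSup_mono fun _ hq => h hq

theorem measurable_noise (G : ℕ → Ω → Matrix (Fin n) (Fin N) ℝ) {S : Set ℕ} {t : ℕ} (ht : t ∈ S)
    (k : Fin n) (i : Fin N) : Measurable[noiseAlgebra G S] fun ω => G t ω k i := by
  have hmem : (t, k, i) ∈ (Prod.fst ⁻¹' S : Set (ℕ × Fin n × Fin N)) := ht
  have hle : entryAlgebra G (t, k, i) ≤ noiseAlgebra G S := le_biSup (entryAlgebra G) hmem
  exact (comap_measurable fun ω => G t ω k i).mono hle le_rfl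

/-- `W_t` is built from the noise at times strictly below `t`, which makes it independent of `G_t`.
-/
theorem measurable_weights (η σ : ℕ → ℝ) (X : Matrix (Fin n) (Fin N) ℝ)
    (Y : Matrix (Fin p) (Fin N) ℝ) (W₀ : Matrix (Fin p) (Fin n) ℝ)
    (G : ℕ → Ω → Matrix (Fin n) (Fin N) ℝ) (t : ℕ) (i : Fin p) (j : Fin n) :
    Measurable[noiseAlgebra G (Set.Iio t)] fun ω =>
      weights η σ X Y W₀ (fun s => G s ω) t i j := by
  induction t generalizing i j with
  | zero => exact measurable_const
  | succ t ih =>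
    have hW : ∀ i j, Measurable[noiseAlgebra G (Set.Iio (t + 1))] fun ω =>
        weights η σ X Y W₀ (fun s => G s ω) t i j := fun i j =>
      (ih i j).mono (noiseAlgebra_mono G (Set.Iio_subset_Iio t.le_succ)) le_rfl
    have hX : ∀ k l, Measurable[noiseAlgebra G (Set.Iio (t + 1))] fun ω =>
        X k l + σ t * G t ω k l := fun k l =>
      ((measurable_noise G (Set.mem_Iio.2 t.lt_succ_self) k l).const_mul _).const_add _
    simp only [weights, gradStep, Matrix.add_apply, Matrix.smul_apply, Matrix.mul_apply,
      Matrix.sub_apply, Matrix.transpose_apply, smul_eq_mul]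
    refine (hW i j).add (Measurable.const_mul ?_ _)
    exact Finset.measurable_sum _ fun k _ =>
      ((Finset.measurable_sum _ fun l _ => (hW i l).mul (hX l k)).const_sub _).mul (hX j k)

variable {mΩ : MeasurableSpace Ω} {μ : Measure Ω} {G : ℕ → Ω → Matrix (Fin n) (Fin N) ℝ}

theorem IsStdGaussianNoise.noiseAlgebra_le (hG : IsStdGaussianNoise μ G) (S : Set ℕ) :
    noiseAlgebra G S ≤ mΩ :=
  iSup₂_le fun q _ => (hG.measurable q.1 q.2.1 q.2.2).comap_le

theorem IsStdGaussianNoise.indep_noiseAlgebra (hG : IsStdGaussianNoise μ G) {S T : Set ℕ}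
    (hST : Disjoint S T) : Indep (noiseAlgebra G S) (noiseAlgebra G T) μ := by
  have hind : iIndep (entryAlgebra G) μ := hG.indep.iIndep
  have hle : ∀ q, entryAlgebra G q ≤ mΩ := fun q => (hG.measurable q.1 q.2.1 q.2.2).comap_le
  have hdisj : Disjoint (Prod.fst ⁻¹' S : Set (ℕ × Fin n × Fin N)) (Prod.fst ⁻¹' T) :=
    hST.preimage _
  exact indep_iSup_of_disjoint hle hind hdisj

theorem IsStdGaussianNoise.memLp (hG : IsStdGaussianNoise μ G) (t : ℕ) (k : Fin n) (i : Fin N)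
    {q : ENNReal} (hq : q ≠ ⊤) : MemLp (fun ω => G t ω k i) q μ := by
  have h := memLp_id_gaussianReal' (μ := 0) (v := 1) q hq
  rw [← (hG.law t k i).map_eq] at h
  exact (memLp_map_measure_iff aestronglyMeasurable_id (hG.law t k i).aemeasurable).1 h

theorem IsStdGaussianNoise.integral_eq_zero (hG : IsStdGaussianNoise μ G) (t : ℕ) (k : Fin n)
    (i : Fin N) : ∫ ω, G t ω k i ∂μ = 0 :=
  (hG.law t k i).integral_eq.trans integral_id_gaussianReal

theorem IsStdGaussianNoise.integral_pow (hG : IsStdGaussianNoise μ G) (t : ℕ) (k : Fin n)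
    (i : Fin N) (m : ℕ) : ∫ ω, G t ω k i ^ m ∂μ = ∫ x, x ^ m ∂gaussianReal 0 1 :=
  (hG.law t k i).integral_comp (f := fun x => x ^ m) (by fun_prop)

theorem integral_sq_gaussianReal : ∫ x, x ^ 2 ∂gaussianReal 0 1 = 1 := by
  have h := variance_fun_id_gaussianReal (μ := 0) (v := 1)
  rw [variance_of_integral_eq_zero (by fun_prop) integral_id_gaussianReal] at h
  simpa using h

theorem IsStdGaussianNoise.integrable_pow (hG : IsStdGaussianNoise μ G) (t : ℕ) (k : Fin n)
    (i : Fin N) (m : ℕ) : Integrable (fun ω => G t ω k i ^ m) μ := by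
  rcases eq_or_ne m 0 with rfl | hm
  · have := (hG.law t k i).isProbabilityMeasure
    simp
  have h := (hG.memLp t k i (q := m) (by simp)).integrable_norm_pow hm
  refine h.mono' ((hG.measurable t k i).pow_const m).aestronglyMeasurable (ae_of_all _ fun ω => ?_)
  rw [norm_pow]

theorem IsStdGaussianNoise.integrable_mul (hG : IsStdGaussianNoise μ G) (t : ℕ) (k l : Fin n)
    (i : Fin N) : Integrable (fun ω => G t ω k i * G t ω l i) μ :=
  MemLp.integrable_mul (p := 2) (q := 2) (hG.memLp t k i (by simp)) (hG.memLp t l i (by simp))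

theorem IsStdGaussianNoise.integral_mul (hG : IsStdGaussianNoise μ G) (t : ℕ) (k l : Fin n)
    (i : Fin N) : ∫ ω, G t ω k i * G t ω l i ∂μ = (1 : Matrix (Fin n) (Fin n) ℝ) k l := by
  rcases eq_or_ne k l with rfl | hkl
  · simp only [← sq, hG.integral_pow, integral_sq_gaussianReal, Matrix.one_apply_eq]
  · have hind : IndepFun (fun ω => G t ω k i) (fun ω => G t ω l i) μ :=
      hG.indep.indepFun (i := (t, k, i)) (j := (t, l, i)) (by simp [hkl])
    rw [Matrix.one_apply_ne hkl, hind.integral_fun_mul_eq_mul_integral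
      (hG.measurable t k i).aestronglyMeasurable (hG.measurable t l i).aestronglyMeasurable,
      hG.integral_eq_zero, zero_mul]

theorem IsStdGaussianNoise.integrable_norm_sq (hG : IsStdGaussianNoise μ G) (t : ℕ) :
    Integrable (fun ω => ‖G t ω‖ ^ 2) μ := by
  simp only [frobenius_sq]
  exact integrable_finsetSum _ fun k _ => integrable_finsetSum _ fun i _ =>
    hG.integrable_pow t k i 2

theorem IsStdGaussianNoise.integral_norm_sq (hG : IsStdGaussianNoise μ G) (t : ℕ) :
    ∫ ω, ‖G t ω‖ ^ 2 ∂μ = n * N := by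
  simp only [frobenius_sq]
  rw [integral_finsetSum _ fun k _ => integrable_finsetSum _ fun i _ => hG.integrable_pow t k i 2]
  simp_rw [integral_finsetSum _ fun i _ => hG.integrable_pow t _ i 2, hG.integral_pow,
    integral_sq_gaussianReal]
  simp

/-- Cauchy–Schwarz over the `n N` entries reduces the fourth moment of the norm to scalar fourth
moments, so no mixed moments are needed. -/
theorem frobenius_pow_four_le (A : Matrix (Fin n) (Fin N) ℝ) :
    (‖A‖ ^ 2) ^ 2 ≤ n * N * ∑ k, ∑ i, A k i ^ 4 := by
  rw [frobenius_sq, ← Finset.sum_product', ← Finset.sum_product']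
  refine sq_sum_le_card_mul_sum_sq.trans (le_of_eq ?_)
  simp [← pow_mul]

theorem IsStdGaussianNoise.integrable_sum_pow_four (hG : IsStdGaussianNoise μ G) (t : ℕ) :
    Integrable (fun ω => n * N * ∑ k, ∑ i, G t ω k i ^ 4) μ :=
  (integrable_finsetSum _ fun k _ => integrable_finsetSum _ fun i _ =>
    hG.integrable_pow t k i 4).const_mul _

theorem IsStdGaussianNoise.integrable_norm_pow_four (hG : IsStdGaussianNoise μ G) (t : ℕ) :
    Integrable (fun ω => (‖G t ω‖ ^ 2) ^ 2) μ := by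
  refine (hG.integrable_sum_pow_four t).mono'
    ((measurable_frobenius_sq (hG.measurable t)).pow_const 2).aestronglyMeasurable
    (ae_of_all _ fun ω => ?_)
  rw [Real.norm_of_nonneg (sq_nonneg _)]
  exact frobenius_pow_four_le _

theorem IsStdGaussianNoise.integral_norm_pow_four_le (hG : IsStdGaussianNoise μ G) (t : ℕ) :
    ∫ ω, (‖G t ω‖ ^ 2) ^ 2 ∂μ ≤ (n * N) ^ 2 * ∫ x, x ^ 4 ∂gaussianReal 0 1 := by
  refine (integral_mono (hG.integrable_norm_pow_four t) (hG.integrable_sum_pow_four t)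
    fun ω => frobenius_pow_four_le _).trans (le_of_eq ?_)
  rw [integral_const_mul, integral_finsetSum _ fun k _ => integrable_finsetSum _ fun i _ =>
    hG.integrable_pow t k i 4]
  simp_rw [integral_finsetSum _ fun i _ => hG.integrable_pow t _ i 4, hG.integral_pow]
  simp
  ring

/-- The centred fluctuation `X_t X_tᵀ - E[X_t X_tᵀ]` for the noise `G` at level `s`. -/
def gramNoise (s : ℝ) (X G : Matrix (Fin n) (Fin N) ℝ) : Matrix (Fin n) (Fin n) ℝ :=
  s • (X * Gᵀ + G * Xᵀ) + s ^ 2 • (G * Gᵀ - (N : ℝ) • 1)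

/-- The part linear in `G` contributes order `s²` and the quadratic part order `s⁴`; when `s` is
bounded the whole is of order `s²`. -/
theorem gramNoise_sq_le (s : ℝ) (X G : Matrix (Fin n) (Fin N) ℝ) :
    ‖gramNoise s X G‖ ^ 2 ≤ s ^ 2 * (8 * ‖X‖ ^ 2 * ‖G‖ ^ 2)
      + (s ^ 2) ^ 2 * (4 * (‖G‖ ^ 2) ^ 2 + 4 * ‖(N : ℝ) • (1 : Matrix (Fin n) (Fin n) ℝ)‖ ^ 2) := by
  have hsmul : ∀ (a : ℝ) (A : Matrix (Fin n) (Fin n) ℝ), ‖a • A‖ ^ 2 = a ^ 2 * ‖A‖ ^ 2 := by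
    intro a A
    rw [norm_smul, mul_pow, Real.norm_eq_abs, sq_abs]
  have h1 : ‖X * Gᵀ + G * Xᵀ‖ ^ 2 ≤ 4 * ‖X‖ ^ 2 * ‖G‖ ^ 2 := by
    have ha := frobenius_mul_sq_le X Gᵀ
    have hb := frobenius_mul_sq_le G Xᵀ
    rw [Matrix.frobenius_norm_transpose] at ha hb
    linarith [norm_add_sq_le_two_mul (X * Gᵀ) (G * Xᵀ)]
  have h2 : ‖G * Gᵀ - (N : ℝ) • 1‖ ^ 2 ≤
      2 * (‖G‖ ^ 2) ^ 2 + 2 * ‖(N : ℝ) • (1 : Matrix (Fin n) (Fin n) ℝ)‖ ^ 2 := by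
    have ha := frobenius_mul_sq_le G Gᵀ
    rw [Matrix.frobenius_norm_transpose] at ha
    linarith [norm_sub_sq_le_two_mul (G * Gᵀ) ((N : ℝ) • 1)]
  refine (norm_add_sq_le_two_mul _ _).trans ?_
  rw [hsmul, hsmul]
  nlinarith [mul_le_mul_of_nonneg_left h1 (sq_nonneg s),
    mul_le_mul_of_nonneg_left h2 (sq_nonneg (s ^ 2))]

theorem measurable_gramNoise (s : ℝ) (X : Matrix (Fin n) (Fin N) ℝ) {t : ℕ} {S : Set ℕ}
    (G : ℕ → Ω → Matrix (Fin n) (Fin N) ℝ) (ht : t ∈ S) (k l : Fin n) :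
    Measurable[noiseAlgebra G S] fun ω => gramNoise s X (G t ω) k l := by
  have hm := measurable_noise G ht
  simp only [gramNoise, Matrix.add_apply, Matrix.smul_apply, Matrix.sub_apply, Matrix.mul_apply,
    Matrix.transpose_apply, smul_eq_mul]
  exact (((Finset.measurable_sum _ fun i _ => (hm l i).const_mul _).add
    (Finset.measurable_sum _ fun i _ => (hm k i).mul_const _)).const_mul _).add
    (((Finset.measurable_sum _ fun i _ => (hm k i).mul (hm l i)).sub_const _).const_mul _)

theorem measurable_mul_noise_transpose (s : ℝ) (Y : Matrix (Fin p) (Fin N) ℝ) {t : ℕ} {S : Set ℕ}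
    (G : ℕ → Ω → Matrix (Fin n) (Fin N) ℝ) (ht : t ∈ S) (k : Fin p) (l : Fin n) :
    Measurable[noiseAlgebra G S] fun ω => (s • (Y * (G t ω)ᵀ)) k l := by
  simp only [Matrix.smul_apply, Matrix.mul_apply, Matrix.transpose_apply, smul_eq_mul]
  exact (Finset.measurable_sum _ fun i _ => (measurable_noise G ht l i).const_mul _).const_mul _

theorem IsStdGaussianNoise.integral_mul_transpose (hG : IsStdGaussianNoise μ G) (s : ℝ)
    (Y : Matrix (Fin p) (Fin N) ℝ) (t : ℕ) (k : Fin p) (l : Fin n) :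
    ∫ ω, (s • (Y * (G t ω)ᵀ)) k l ∂μ = 0 := by
  have h1 : ∀ i, Integrable (fun ω => G t ω l i) μ := fun i => by
    simpa using hG.integrable_pow t l i 1
  simp only [Matrix.smul_apply, Matrix.mul_apply, Matrix.transpose_apply, smul_eq_mul]
  rw [integral_const_mul, integral_finsetSum _ fun i _ => (h1 i).const_mul _]
  simp [integral_const_mul, hG.integral_eq_zero]

theorem IsStdGaussianNoise.integral_gramNoise [IsProbabilityMeasure μ]
    (hG : IsStdGaussianNoise μ G) (s : ℝ) (X : Matrix (Fin n) (Fin N) ℝ) (t : ℕ) (k l : Fin n) :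
    ∫ ω, gramNoise s X (G t ω) k l ∂μ = 0 := by
  have h1 : ∀ k i, Integrable (fun ω => G t ω k i) μ := fun k i => by
    simpa using hG.integrable_pow t k i 1
  have ha : Integrable (fun ω => ∑ i, X k i * G t ω l i) μ :=
    integrable_finsetSum _ fun i _ => (h1 l i).const_mul _
  have hb : Integrable (fun ω => ∑ i, G t ω k i * X l i) μ :=
    integrable_finsetSum _ fun i _ => (h1 k i).mul_const _
  have hc : Integrable (fun ω => ∑ i, G t ω k i * G t ω l i) μ :=
    integrable_finsetSum _ fun i _ => hG.integrable_mul t k l i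
  have ha0 : ∫ ω, ∑ i, X k i * G t ω l i ∂μ = 0 := by
    rw [integral_finsetSum _ fun i _ => (h1 l i).const_mul _]
    simp [integral_const_mul, hG.integral_eq_zero]
  have hb0 : ∫ ω, ∑ i, G t ω k i * X l i ∂μ = 0 := by
    rw [integral_finsetSum _ fun i _ => (h1 k i).mul_const _]
    simp [integral_mul_const, hG.integral_eq_zero]
  have hc0 : ∫ ω, ∑ i, G t ω k i * G t ω l i ∂μ = N * (1 : Matrix (Fin n) (Fin n) ℝ) k l := by
    rw [integral_finsetSum _ fun i _ => hG.integrable_mul t k l i]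
    simp [hG.integral_mul]
  have hab : Integrable (fun ω => s * (∑ i, X k i * G t ω l i + ∑ i, G t ω k i * X l i)) μ :=
    (ha.add hb).const_mul _
  have hcd : Integrable (fun ω => s ^ 2 * (∑ i, G t ω k i * G t ω l i
      - N * (1 : Matrix (Fin n) (Fin n) ℝ) k l)) μ := (hc.sub (integrable_const _)).const_mul _
  simp only [gramNoise, Matrix.add_apply, Matrix.smul_apply, Matrix.sub_apply, Matrix.mul_apply,
    Matrix.transpose_apply, smul_eq_mul]
  rw [integral_add hab hcd, integral_const_mul, integral_const_mul, integral_add ha hb,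
    integral_sub hc (integrable_const _), ha0, hb0, hc0]
  simp

/-- Uniform second-moment bounds for the fluctuations of `Y X_tᵀ` and `X_t X_tᵀ`. -/
theorem IsStdGaussianNoise.exists_moment_bound [IsProbabilityMeasure μ]
    (hG : IsStdGaussianNoise μ G) (X : Matrix (Fin n) (Fin N) ℝ) (Y : Matrix (Fin p) (Fin N) ℝ) :
    ∃ C : ℝ, 0 ≤ C ∧ ∀ (s : ℝ) (t : ℕ),
      Integrable (fun ω => ‖s • (Y * (G t ω)ᵀ)‖ ^ 2) μ ∧
      Integrable (fun ω => ‖gramNoise s X (G t ω)‖ ^ 2) μ ∧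
      ∫ ω, ‖s • (Y * (G t ω)ᵀ)‖ ^ 2 ∂μ ≤ C * s ^ 2 ∧
      ∫ ω, ‖gramNoise s X (G t ω)‖ ^ 2 ∂μ ≤ C * (s ^ 2 + (s ^ 2) ^ 2) := by
  set I := ‖(N : ℝ) • (1 : Matrix (Fin n) (Fin n) ℝ)‖ ^ 2
  set K := ∫ x, x ^ 4 ∂gaussianReal 0 1
  have hK : 0 ≤ K := integral_nonneg fun x => by positivity
  have hI : 0 ≤ I := by positivity
  refine ⟨‖Y‖ ^ 2 * (n * N) + 8 * ‖X‖ ^ 2 * (n * N) + (4 * ((n * N) ^ 2 * K) + 4 * I),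
    by positivity, fun s t => ?_⟩
  have hH : ∀ ω, ‖s • (Y * (G t ω)ᵀ)‖ ^ 2 ≤ s ^ 2 * ‖Y‖ ^ 2 * ‖G t ω‖ ^ 2 := by
    intro ω
    have h := frobenius_mul_sq_le Y (G t ω)ᵀ
    rw [Matrix.frobenius_norm_transpose] at h
    rw [norm_smul, mul_pow, Real.norm_eq_abs, sq_abs, mul_assoc]
    exact mul_le_mul_of_nonneg_left h (sq_nonneg s)
  have hHd : Integrable (fun ω => s ^ 2 * ‖Y‖ ^ 2 * ‖G t ω‖ ^ 2) μ :=
    (hG.integrable_norm_sq t).const_mul _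
  have hKd1 : Integrable (fun ω => s ^ 2 * (8 * ‖X‖ ^ 2 * ‖G t ω‖ ^ 2)) μ :=
    ((hG.integrable_norm_sq t).const_mul _).const_mul _
  have hKd2 : Integrable (fun ω => 4 * (‖G t ω‖ ^ 2) ^ 2) μ :=
    (hG.integrable_norm_pow_four t).const_mul _
  have hKd3 : Integrable (fun ω => (s ^ 2) ^ 2 * (4 * (‖G t ω‖ ^ 2) ^ 2 + 4 * I)) μ :=
    (hKd2.add (integrable_const _)).const_mul _
  have hKd : Integrable (fun ω => s ^ 2 * (8 * ‖X‖ ^ 2 * ‖G t ω‖ ^ 2)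
      + (s ^ 2) ^ 2 * (4 * (‖G t ω‖ ^ 2) ^ 2 + 4 * I)) μ := hKd1.add hKd3
  have hHi : Integrable (fun ω => ‖s • (Y * (G t ω)ᵀ)‖ ^ 2) μ := by
    refine hHd.mono' (measurable_frobenius_sq fun k l =>
      (measurable_mul_noise_transpose s Y G (Set.mem_univ t) k l).mono (hG.noiseAlgebra_le _)
        le_rfl).aestronglyMeasurable (ae_of_all _ fun ω => ?_)
    rw [Real.norm_of_nonneg (sq_nonneg _)]
    exact hH ω
  have hKi : Integrable (fun ω => ‖gramNoise s X (G t ω)‖ ^ 2) μ := by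
    refine hKd.mono' (measurable_frobenius_sq fun k l =>
      (measurable_gramNoise s X G (Set.mem_univ t) k l).mono (hG.noiseAlgebra_le _)
        le_rfl).aestronglyMeasurable (ae_of_all _ fun ω => ?_)
    rw [Real.norm_of_nonneg (sq_nonneg _)]
    exact gramNoise_sq_le s X _
  have hs := sq_nonneg s
  have hs4 := sq_nonneg (s ^ 2)
  have hnN : (0 : ℝ) ≤ n * N := by positivity
  refine ⟨hHi, hKi, (integral_mono hHi hHd hH).trans ?_,
    (integral_mono hKi hKd fun ω => gramNoise_sq_le s X _).trans ?_⟩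
  · rw [integral_const_mul, hG.integral_norm_sq]
    have : 0 ≤ (8 * ‖X‖ ^ 2 * (n * N) + (4 * ((n * N) ^ 2 * K) + 4 * I)) * s ^ 2 := by positivity
    linarith
  · rw [integral_add hKd1 hKd3]
    simp only [integral_const_mul]
    rw [integral_add hKd2 (integrable_const _), integral_const_mul, hG.integral_norm_sq]
    simp only [integral_const, probReal_univ, one_smul]
    have h4 := mul_le_mul_of_nonneg_left (hG.integral_norm_pow_four_le t) hs4
    have e1 : 0 ≤ ‖Y‖ ^ 2 * (n * N) * (s ^ 2 + (s ^ 2) ^ 2) := by positivity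
    have e2 : 0 ≤ 8 * ‖X‖ ^ 2 * (n * N) * (s ^ 2) ^ 2 := by positivity
    have e3 : 0 ≤ (4 * ((n * N) ^ 2 * K) + 4 * I) * s ^ 2 := by positivity
    linarith

end GaussAug

end Noise

section Convergence

attribute [local instance] Matrix.frobeniusNormedSpace

namespace GaussAug

/-! ### Convergence of the weights -/

variable {Ω : Type*} {mΩ : MeasurableSpace Ω} {μ : Measure Ω} {n p N : ℕ}
  {G : ℕ → Ω → Matrix (Fin n) (Fin N) ℝ} {η σ r : ℕ → ℝ}

/-- The bracket is the expected step applied to the past fluctuation; the last term is centred given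
the past. The Gram noise multiplies `W_t` itself, so its variance involves `E‖W_t‖²`. -/
theorem weights_succ_sub (hN : 0 < N) (η σ : ℕ → ℝ) (X : Matrix (Fin n) (Fin N) ℝ)
    (Y : Matrix (Fin p) (Fin N) ℝ) (W₀ : Matrix (Fin p) (Fin n) ℝ)
    (g : ℕ → Matrix (Fin n) (Fin N) ℝ) (t : ℕ) :
    weights η σ X Y W₀ g (t + 1) - meanWeights η σ X Y W₀ (t + 1) =
      ((1 - 2 * (η t * σ t ^ 2)) • (weights η σ X Y W₀ g t - meanWeights η σ X Y W₀ t)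
        - (2 * η t / N) • ((weights η σ X Y W₀ g t - meanWeights η σ X Y W₀ t) * (X * Xᵀ)))
      + (2 * η t / N) • (σ t • (Y * (g t)ᵀ) - weights η σ X Y W₀ g t * gramNoise (σ t) X (g t)) := by
  have hN' : (N : ℝ) ≠ 0 := by positivity
  have h : 2 * (η t * σ t ^ 2) = 2 * η t / N * (N * σ t ^ 2) := by field_simp
  rw [weights, meanWeights, gradStep, gramNoise, h]
  simp only [Matrix.mul_add, Matrix.add_mul, Matrix.sub_mul, Matrix.mul_sub, Matrix.mul_smul,
    Matrix.smul_mul, Matrix.mul_one, Matrix.transpose_add, Matrix.transpose_smul, Matrix.mul_assoc]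
  module

/-- Orthogonality of the fresh noise to the past removes the cross term. Bounding `E‖W_t‖²` by the
variance and `‖M_t‖²` closes the recursion in the variance alone. -/
theorem IsStdGaussianNoise.second_moment_succ [IsProbabilityMeasure μ]
    (hG : IsStdGaussianNoise μ G) (hN : 0 < N) (η σ : ℕ → ℝ) (X : Matrix (Fin n) (Fin N) ℝ)
    (Y : Matrix (Fin p) (Fin N) ℝ) (W₀ : Matrix (Fin p) (Fin n) ℝ) {C : ℝ}
    (hC : ∀ (s : ℝ) (t : ℕ),
      Integrable (fun ω => ‖s • (Y * (G t ω)ᵀ)‖ ^ 2) μ ∧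
      Integrable (fun ω => ‖gramNoise s X (G t ω)‖ ^ 2) μ ∧
      ∫ ω, ‖s • (Y * (G t ω)ᵀ)‖ ^ 2 ∂μ ≤ C * s ^ 2 ∧
      ∫ ω, ‖gramNoise s X (G t ω)‖ ^ 2 ∂μ ≤ C * (s ^ 2 + (s ^ 2) ^ 2)) (t : ℕ)
    (hint : Integrable (fun ω =>
      ‖weights η σ X Y W₀ (fun s => G s ω) t - meanWeights η σ X Y W₀ t‖ ^ 2) μ) :
    Integrable (fun ω =>
      ‖weights η σ X Y W₀ (fun s => G s ω) (t + 1) - meanWeights η σ X Y W₀ (t + 1)‖ ^ 2) μ ∧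
    ∫ ω, ‖weights η σ X Y W₀ (fun s => G s ω) (t + 1) - meanWeights η σ X Y W₀ (t + 1)‖ ^ 2 ∂μ ≤
      ∫ ω, ‖(1 - 2 * (η t * σ t ^ 2)) •
          (weights η σ X Y W₀ (fun s => G s ω) t - meanWeights η σ X Y W₀ t)
        - (2 * η t / N) • ((weights η σ X Y W₀ (fun s => G s ω) t - meanWeights η σ X Y W₀ t)
          * (X * Xᵀ))‖ ^ 2 ∂μ
      + (2 * η t / N) ^ 2 * (2 * (C * σ t ^ 2) + 2 * ((2 * ∫ ω,
          ‖weights η σ X Y W₀ (fun s => G s ω) t - meanWeights η σ X Y W₀ t‖ ^ 2 ∂μ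
          + 2 * ‖meanWeights η σ X Y W₀ t‖ ^ 2) * (C * (σ t ^ 2 + (σ t ^ 2) ^ 2)))) := by
  set W : Ω → Matrix (Fin p) (Fin n) ℝ := fun ω => weights η σ X Y W₀ (fun s => G s ω) t
  set M := meanWeights η σ X Y W₀ t
  set a := 1 - 2 * (η t * σ t ^ 2)
  set c := 2 * η t / N
  have hWm : ∀ i j, Measurable[noiseAlgebra G (Set.Iio t)] fun ω => W ω i j :=
    measurable_weights η σ X Y W₀ G t
  have hZm : ∀ i j, Measurable[noiseAlgebra G (Set.Iio t)] fun ω => (W ω - M) i j := fun i j =>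
    (hWm i j).sub_const _
  have hVm : ∀ i j, Measurable[noiseAlgebra G (Set.Iio t)] fun ω =>
      (a • (W ω - M) - c • ((W ω - M) * (X * Xᵀ))) i j := by
    intro i j
    simp only [Matrix.sub_apply (a • _), Matrix.smul_apply, Matrix.mul_apply (M := _ - M),
      smul_eq_mul]
    exact ((hZm i j).const_mul _).sub
      ((Finset.measurable_sum _ fun k _ => (hZm i k).mul_const _).const_mul _)
  have hle := hG.noiseAlgebra_le (Set.Iio t)
  have hW2 : Integrable (fun ω => ‖W ω‖ ^ 2) μ := by
    refine ((hint.const_mul 2).add (integrable_const (2 * ‖M‖ ^ 2))).mono'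
      ((measurable_frobenius_sq hWm).mono hle le_rfl).aestronglyMeasurable
      (ae_of_all _ fun ω => ?_)
    rw [Real.norm_of_nonneg (sq_nonneg _)]
    simpa using norm_add_sq_le_two_mul (W ω - M) M
  have hV2 : Integrable (fun ω => ‖a • (W ω - M) - c • ((W ω - M) * (X * Xᵀ))‖ ^ 2) μ := by
    refine (hint.const_mul (2 * a ^ 2 + 2 * (c ^ 2 * ‖X * Xᵀ‖ ^ 2))).mono'
      ((measurable_frobenius_sq hVm).mono hle le_rfl).aestronglyMeasurable
      (ae_of_all _ fun ω => ?_)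
    rw [Real.norm_of_nonneg (sq_nonneg _)]
    refine (norm_sub_sq_le_two_mul _ _).trans ?_
    rw [norm_smul, norm_smul, mul_pow, mul_pow, Real.norm_eq_abs, Real.norm_eq_abs, sq_abs, sq_abs]
    have := mul_le_mul_of_nonneg_left (frobenius_mul_sq_le (W ω - M) (X * Xᵀ)) (sq_nonneg c)
    linarith
  have hWint : ∫ ω, ‖W ω‖ ^ 2 ∂μ ≤ 2 * ∫ ω, ‖W ω - M‖ ^ 2 ∂μ + 2 * ‖M‖ ^ 2 := by
    refine (integral_mono hW2 ((hint.const_mul 2).add (integrable_const (2 * ‖M‖ ^ 2)))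
      fun ω => ?_).trans (le_of_eq ?_)
    · simpa using norm_add_sq_le_two_mul (W ω - M) M
    · rw [integral_add' (hint.const_mul 2) (integrable_const _), integral_const_mul]
      simp [W]
  have hdisj : Disjoint (Set.Iio t) {t} := by simp
  obtain ⟨hHi, hKi, hHb, hKb⟩ := hC (σ t) t
  have hstep := second_moment_step hle (hG.noiseAlgebra_le {t}) (hG.indep_noiseAlgebra hdisj)
    hVm hWm (measurable_mul_noise_transpose (σ t) Y G (Set.mem_singleton t))
    (measurable_gramNoise (σ t) X G (Set.mem_singleton t)) hV2 hW2 hHi hKi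
    (hG.integral_mul_transpose (σ t) Y t) (hG.integral_gramNoise (σ t) X t) c
  simp only [weights_succ_sub hN]
  refine ⟨hstep.1, hstep.2.trans ?_⟩
  have hW0 : 0 ≤ ∫ ω, ‖W ω‖ ^ 2 ∂μ := integral_nonneg fun ω => sq_nonneg _
  have hK0 : 0 ≤ ∫ ω, ‖gramNoise (σ t) X (G t ω)‖ ^ 2 ∂μ := integral_nonneg fun ω => sq_nonneg _
  have hprod := mul_le_mul hWint hKb hK0 (hW0.trans hWint)
  gcongr

theorem IsStdGaussianNoise.integrable_second_moment [IsProbabilityMeasure μ]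
    (hG : IsStdGaussianNoise μ G) (hN : 0 < N) (η σ : ℕ → ℝ) (X : Matrix (Fin n) (Fin N) ℝ)
    (Y : Matrix (Fin p) (Fin N) ℝ) (W₀ : Matrix (Fin p) (Fin n) ℝ) (t : ℕ) :
    Integrable (fun ω =>
      ‖weights η σ X Y W₀ (fun s => G s ω) t - meanWeights η σ X Y W₀ t‖ ^ 2) μ := by
  obtain ⟨C, -, hC⟩ := hG.exists_moment_bound X Y
  induction t with
  | zero => simp [weights, meanWeights]
  | succ t ih => exact (hG.second_moment_succ hN η σ X Y W₀ hC t ih).1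

/-- The injected noise is at most `η σ² · D η · (1 + v)`. Part of the contraction `2 η σ²` absorbs
the term in `v`, leaving rate `η σ²` and level `D η`. -/
theorem IsStdGaussianNoise.tendsto_second_moment [IsProbabilityMeasure μ]
    (hG : IsStdGaussianNoise μ G) (hN : 0 < N) (X : Matrix (Fin n) (Fin N) ℝ)
    (Y : Matrix (Fin p) (Fin N) ℝ) (W₀ : Matrix (Fin p) (Fin n) ℝ) (hη : ∀ t, 0 ≤ η t)
    (hη0 : Tendsto η atTop (𝓝 0)) (hσ : Tendsto (fun t => σ t ^ 2) atTop (𝓝 0))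
    (hdiv : ¬ Summable fun t => η t * σ t ^ 2) (hr : ∀ t, 0 ≤ r t)
    (hgrow : ∀ θ > 0, ∀ᶠ t in atTop, r (t + 1) ≤ (1 + θ * (η t * σ t ^ 2)) * r t)
    (hrη : Tendsto (fun t => r t ^ 2 * η t) atTop (𝓝 0)) :
    Tendsto (fun t => r t ^ 2 * ∫ ω,
      ‖weights η σ X Y W₀ (fun s => G s ω) t - meanWeights η σ X Y W₀ t‖ ^ 2 ∂μ) atTop (𝓝 0) := by
  obtain ⟨C, hC0, hC⟩ := hG.exists_moment_bound X Y
  have hησ : ∀ t, 0 ≤ η t * σ t ^ 2 := fun t => mul_nonneg (hη t) (sq_nonneg _)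
  -- The unweighted bias estimate is needed only to bound `‖M_t‖` eventually.
  have hmean : Tendsto (fun t => ‖meanWeights η σ X Y W₀ t - wMin X Y‖) atTop (𝓝 0) := by
    have := tendsto_meanWeights (r := fun _ => 1) hN X Y W₀ hη hη0 hσ hdiv
      (fun _ => zero_le_one) (fun θ hθ => .of_forall fun t => by
        have := mul_nonneg hθ.le (hησ t)
        linarith) (by simpa using hσ)
    simpa using this
  set B : ℝ := (1 + ‖wMin X Y‖) ^ 2
  have hB : ∀ᶠ t in atTop, ‖meanWeights η σ X Y W₀ t‖ ^ 2 ≤ B := by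
    filter_upwards [hmean.eventually_le_const zero_lt_one] with t ht
    refine pow_le_pow_left₀ (norm_nonneg _) ?_ 2
    have := norm_add_le (meanWeights η σ X Y W₀ t - wMin X Y) (wMin X Y)
    rw [sub_add_cancel] at this
    linarith
  have hB0 : 0 ≤ B := by positivity
  set D : ℝ := (2 / N) ^ 2 * (8 * C * (1 + B)) with hDdef
  have hD : 0 ≤ D := by positivity
  refine tendsto_weighted_zero_of_contraction (b := fun t => η t * σ t ^ 2)
    (s := fun t => D * η t) (r := fun t => r t ^ 2)
    (fun t => integral_nonneg fun ω => sq_nonneg _) (fun t => sq_nonneg _) ?_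
    (.of_forall fun t => mul_nonneg hD (hη t)) ?_ hdiv ?_ ?_
  · filter_upwards [eventually_step_small hη0 hσ 0 one_pos] with t ht
    exact ⟨hησ t, ht.1⟩
  · have := hrη.const_mul D
    rw [mul_zero] at this
    exact this.congr fun t => by ring
  -- The weight here is `r²`, and `(1 + q/8)² ≤ 1 + q/2` for `0 ≤ q ≤ 1`.
  · filter_upwards [hgrow (1 / 8) (by norm_num), eventually_step_small hη0 hσ 0 one_pos]
      with t ht hsmall
    refine (pow_le_pow_left₀ (hr _) ht 2).trans ?_
    rw [mul_pow]
    refine mul_le_mul_of_nonneg_right ?_ (sq_nonneg _)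
    nlinarith [hησ t, hsmall.1, mul_le_mul_of_nonneg_left hsmall.1 (hησ t)]
  · filter_upwards [eventually_step_small hη0 hσ (2 / N * ‖X‖ ^ 2)
        (show (0 : ℝ) < 1 / 4 by norm_num),
      eventually_step_small hη0 hσ D one_pos, hB] with t ⟨h1, h2, h3⟩ ⟨_, h4, _⟩ h5
    have hint := hG.integrable_second_moment hN η σ X Y W₀ t
    refine (hG.second_moment_succ hN η σ X Y W₀ hC t hint).2.trans ?_
    set M := meanWeights η σ X Y W₀ t
    set v := ∫ ω, ‖weights η σ X Y W₀ (fun s => G s ω) t - M‖ ^ 2 ∂μ with hv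
    have hv0 : 0 ≤ v := integral_nonneg fun ω => sq_nonneg _
    have hq := hησ t
    have hσ0 := sq_nonneg (σ t)
    have hcontr : ∫ ω, ‖(1 - 2 * (η t * σ t ^ 2)) • (weights η σ X Y W₀ (fun s => G s ω) t - M)
        - (2 * η t / N) • ((weights η σ X Y W₀ (fun s => G s ω) t - M) * (X * Xᵀ))‖ ^ 2 ∂μ
        ≤ (1 - 2 * (η t * σ t ^ 2)) * v := by
      rw [hv, ← integral_const_mul]
      refine integral_mono_of_nonneg (ae_of_all _ fun ω => sq_nonneg _) (hint.const_mul _)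
        (ae_of_all _ fun ω => ?_)
      have := frobenius_shrink_le X (weights η σ X Y W₀ (fun s => G s ω) t - M)
        (a := 1 - 2 * (η t * σ t ^ 2)) (c := 2 * η t / N) (by linarith)
        (div_nonneg (by linarith [hη t]) (Nat.cast_nonneg N))
        (by
          have : 2 * η t / N * ‖X‖ ^ 2 = η t * (2 / N * ‖X‖ ^ 2) := by ring
          linarith)
      refine (pow_le_pow_left₀ (norm_nonneg _) this 2).trans ?_
      rw [mul_pow]
      refine mul_le_mul_of_nonneg_right ?_ (sq_nonneg _)
      nlinarith
    have hnoise : 2 * (C * σ t ^ 2) + 2 * ((2 * v + 2 * ‖M‖ ^ 2) * (C * (σ t ^ 2 + (σ t ^ 2) ^ 2)))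
        ≤ 8 * C * (1 + B) * σ t ^ 2 * (1 + v) := by
      have hs4 : σ t ^ 2 + (σ t ^ 2) ^ 2 ≤ 2 * σ t ^ 2 := by nlinarith
      calc _ ≤ 2 * (C * σ t ^ 2) + 2 * ((2 * v + 2 * B) * (C * (2 * σ t ^ 2))) := by gcongr
        _ ≤ _ := by
          have : 0 ≤ C * σ t ^ 2 * (6 + 8 * B * v) := by positivity
          linarith
    calc _ ≤ (1 - 2 * (η t * σ t ^ 2)) * v
          + (2 * η t / N) ^ 2 * (8 * C * (1 + B) * σ t ^ 2 * (1 + v)) := by gcongr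
      _ = (1 - 2 * (η t * σ t ^ 2)) * v + η t * σ t ^ 2 * (η t * D) * (1 + v) := by
          rw [hDdef]
          ring
      -- Since `η D ≤ 1`, the term `η σ² (η D) v` costs at most half of the contraction.
      _ ≤ _ := by nlinarith [mul_nonneg (mul_nonneg hq hv0) (sub_nonneg.2 h4)]

/-- Convergence in probability at the rate `1 / r`, for weights `r` that grow slowly compared
with the total contraction `η σ²` of the dynamics. -/
theorem IsStdGaussianNoise.tendstoInMeasure_weighted [IsProbabilityMeasure μ]
    (hG : IsStdGaussianNoise μ G) (hN : 0 < N) (X : Matrix (Fin n) (Fin N) ℝ)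
    (Y : Matrix (Fin p) (Fin N) ℝ) (W₀ : Matrix (Fin p) (Fin n) ℝ) (hη : ∀ t, 0 ≤ η t)
    (hη0 : Tendsto η atTop (𝓝 0)) (hσ : Tendsto (fun t => σ t ^ 2) atTop (𝓝 0))
    (hdiv : ¬ Summable fun t => η t * σ t ^ 2) (hr : ∀ t, 0 ≤ r t)
    (hgrow : ∀ θ > 0, ∀ᶠ t in atTop, r (t + 1) ≤ (1 + θ * (η t * σ t ^ 2)) * r t)
    (hrσ : Tendsto (fun t => r t * σ t ^ 2) atTop (𝓝 0))
    (hrη : Tendsto (fun t => r t ^ 2 * η t) atTop (𝓝 0)) :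
    TendstoInMeasure μ
      (fun t ω => r t * ‖weights η σ X Y W₀ (fun s => G s ω) t - wMin X Y‖) atTop
      (fun _ => (0 : ℝ)) := by
  rw [tendstoInMeasure_iff_measureReal_dist]
  intro ε hε
  have hvar := hG.tendsto_second_moment hN X Y W₀ hη hη0 hσ hdiv hr hgrow hrη
  have hmean := tendsto_meanWeights hN X Y W₀ hη hη0 hσ hdiv hr hgrow hrσ
  have hbound : Tendsto (fun t => (ε ^ 2)⁻¹ * (2 * (r t ^ 2 * ∫ ω,
      ‖weights η σ X Y W₀ (fun s => G s ω) t - meanWeights η σ X Y W₀ t‖ ^ 2 ∂μ)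
      + 2 * (r t * ‖meanWeights η σ X Y W₀ t - wMin X Y‖) ^ 2)) atTop (𝓝 0) := by
    simpa using ((hvar.const_mul 2).add ((hmean.pow 2).const_mul 2)).const_mul (ε ^ 2)⁻¹
  refine squeeze_zero (fun t => measureReal_nonneg) (fun t => ?_) hbound
  have hint := hG.integrable_second_moment hN η σ X Y W₀ t
  set M := meanWeights η σ X Y W₀ t
  have hdom : Integrable (fun ω => 2 * (r t ^ 2 * ‖weights η σ X Y W₀ (fun s => G s ω) t - M‖ ^ 2)
      + 2 * (r t * ‖M - wMin X Y‖) ^ 2) μ :=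
    ((hint.const_mul _).const_mul _).add (integrable_const _)
  -- Squaring the event and separating variance from bias puts it in a form to which Markov's
  -- inequality applies.
  have hsub : {ω | ε ≤ dist (r t * ‖weights η σ X Y W₀ (fun s => G s ω) t - wMin X Y‖) 0} ⊆
      {ω | ε ^ 2 ≤ 2 * (r t ^ 2 * ‖weights η σ X Y W₀ (fun s => G s ω) t - M‖ ^ 2)
        + 2 * (r t * ‖M - wMin X Y‖) ^ 2} := by
    intro ω hω
    simp only [Set.mem_ofPred_eq, Real.dist_eq, sub_zero] at hω ⊢
    have h1 := pow_le_pow_left₀ hε.le hω 2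
    rw [sq_abs, mul_pow] at h1
    have h2 := norm_add_sq_le_two_mul (weights η σ X Y W₀ (fun s => G s ω) t - M) (M - wMin X Y)
    rw [sub_add_sub_cancel] at h2
    have h3 := mul_le_mul_of_nonneg_left h2 (sq_nonneg (r t))
    rw [mul_pow]
    linarith
  have hmarkov := mul_meas_ge_le_integral_of_nonneg (ae_of_all μ fun ω => by positivity) hdom
    (ε ^ 2)
  rw [integral_add ((hint.const_mul _).const_mul _) (integrable_const _), integral_const_mul,
    integral_const_mul, integral_const, probReal_univ, one_smul] at hmarkov
  rw [inv_mul_eq_div, le_div_iff₀' (by positivity)]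
  exact (mul_le_mul_of_nonneg_left (measureReal_mono hsub) (sq_nonneg ε)).trans hmarkov

end GaussAug

end Convergence

namespace GaussAug

/-! ### Polynomial schedules -/

theorem tendsto_rpow_neg_nat {x : ℝ} (hx : 0 < x) :
    Tendsto (fun t : ℕ => (t : ℝ) ^ (-x)) atTop (𝓝 0) :=
  (tendsto_rpow_neg_atTop hx).comp tendsto_natCast_atTop_atTop

theorem rpow_mul_isBigO_rpow {f : ℕ → ℝ} {x : ℝ} (hf : f =O[atTop] fun t : ℕ => (t : ℝ) ^ (-x))
    (γ : ℝ) : (fun t : ℕ => (t : ℝ) ^ γ * f t) =O[atTop] fun t : ℕ => (t : ℝ) ^ (-(x - γ)) := by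
  refine ((isBigO_refl (fun t : ℕ => (t : ℝ) ^ γ) atTop).mul hf).congr' .rfl ?_
  filter_upwards [eventually_gt_atTop 0] with t ht
  rw [← Real.rpow_add (by positivity)]
  congr 1
  ring

theorem rpow_isBigO_mul {f g : ℕ → ℝ} {x y : ℝ} (hf : (fun t : ℕ => (t : ℝ) ^ (-x)) =O[atTop] f)
    (hg : (fun t : ℕ => (t : ℝ) ^ (-y)) =O[atTop] g) :
    (fun t : ℕ => (t : ℝ) ^ (-(x + y))) =O[atTop] fun t => f t * g t := by
  refine (hf.mul hg).congr' ?_ .rfl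
  filter_upwards [eventually_gt_atTop 0] with t ht
  rw [← Real.rpow_add (by positivity)]
  congr 1
  ring

/-- The ratio is `(1 + 1/t)^γ` with base at least 1, hence at most `1 + 1/t`. Negative `γ` is
covered, as happens when `ε` is large. -/
theorem natCast_add_one_rpow_le {γ : ℝ} (hγ : γ ≤ 1) {t : ℕ} (ht : 0 < t) :
    ((t + 1 : ℕ) : ℝ) ^ γ ≤ (1 + (t : ℝ)⁻¹) * (t : ℝ) ^ γ := by
  have ht' : (0 : ℝ) < t := by positivity
  have hinv : 0 < (t : ℝ)⁻¹ := by positivity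
  have hfac : ((t + 1 : ℕ) : ℝ) = (1 + (t : ℝ)⁻¹) * t := by
    push_cast
    field_simp
  rw [hfac, Real.mul_rpow (by positivity) ht'.le]
  refine mul_le_mul_of_nonneg_right ?_ (by positivity)
  calc (1 + (t : ℝ)⁻¹) ^ γ ≤ (1 + (t : ℝ)⁻¹) ^ (1 : ℝ) :=
        Real.rpow_le_rpow_of_exponent_le (by linarith) hγ
    _ = _ := Real.rpow_one _

/-- Powers of `t` of exponent at most one grow slowly compared with any rate dominating
`t ^ (-z)` for some `z < 1`. -/
theorem eventually_rpow_growth {b : ℕ → ℝ} (hb : ∀ t, 0 ≤ b t) {z γ : ℝ} (hz : z < 1)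
    (hγ : γ ≤ 1) (h : (fun t : ℕ => (t : ℝ) ^ (-z)) =O[atTop] b) {θ : ℝ} (hθ : 0 < θ) :
    ∀ᶠ t : ℕ in atTop, ((t + 1 : ℕ) : ℝ) ^ γ ≤ (1 + θ * b t) * (t : ℝ) ^ γ := by
  -- Write `t⁻¹ = t^(-(1 - z)) t^(-z)`, whose first factor vanishes as `z < 1`.
  have hlit : (fun t : ℕ => (t : ℝ)⁻¹) =o[atTop] fun t : ℕ => (t : ℝ) ^ (-z) := by
    have hone := (isLittleO_one_iff ℝ).2 (tendsto_rpow_neg_nat (show 0 < 1 - z by linarith))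
    refine (hone.mul_isBigO (isBigO_refl (fun t : ℕ => (t : ℝ) ^ (-z)) atTop)).congr' ?_ ?_
    · filter_upwards [eventually_gt_atTop 0] with t ht
      rw [← Real.rpow_add (by positivity), ← Real.rpow_neg_one]
      congr 1
      ring
    · simp
  filter_upwards [(hlit.trans_isBigO h).bound hθ, eventually_gt_atTop 0] with t ht ht0
  refine (natCast_add_one_rpow_le hγ ht0).trans (mul_le_mul_of_nonneg_right ?_ (by positivity))
  rw [Real.norm_of_nonneg (by positivity), Real.norm_of_nonneg (hb t)] at ht
  linarith

end GaussAug

theorem theorem4p1 {Ω : Type*} [MeasurableSpace Ω] (μ : Measure Ω) [IsProbabilityMeasure μ]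
    (n p N : ℕ) (hN : 0 < N)
    (X : Matrix (Fin n) (Fin N) ℝ) (Y : Matrix (Fin p) (Fin N) ℝ)
    (W₀ : Matrix (Fin p) (Fin n) ℝ)
    (G : ℕ → Ω → Matrix (Fin n) (Fin N) ℝ) (hG : GaussAug.IsStdGaussianNoise μ G)
    (η σ : ℕ → ℝ) (hη : ∀ t, 0 ≤ η t) :
    (Tendsto (fun t => σ t ^ 2) atTop (𝓝 0) →
      Tendsto η atTop (𝓝 0) →
      Antitone (fun t => σ t ^ 2) →
      Tendsto (fun T => ∑ t ∈ Finset.range T, η t * σ t ^ 2) atTop atTop →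
      Summable (fun t => η t ^ 2 * σ t ^ 2) →
      TendstoInMeasure μ
        (fun t ω => GaussAug.weights η σ X Y W₀ (fun s => G s ω) t)
        atTop (fun _ => GaussAug.wMin X Y)) ∧
    (∀ x y : ℝ, 0 < x → 0 < y → x + y < 1 → 1 < 2 * x + y →
      η =Θ[atTop] (fun t : ℕ => (t : ℝ) ^ (-x)) →
      (fun t => σ t ^ 2) =Θ[atTop] (fun t : ℕ => (t : ℝ) ^ (-y)) →
      ∀ ε : ℝ, 0 < ε →
      TendstoInMeasure μ
        (fun (t : ℕ) ω => (t : ℝ) ^ (min y (x / 2) - ε) *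
          ‖GaussAug.weights η σ X Y W₀ (fun s => G s ω) t - GaussAug.wMin X Y‖)
        atTop (fun _ => (0 : ℝ))) := by
  refine ⟨fun hσ hη0 _ hdiv _ => ?_, fun x y hx hy hxy _ hηx hσy ε hε => ?_⟩
  · have hησ : ∀ t, 0 ≤ η t * σ t ^ 2 := fun t => mul_nonneg (hη t) (sq_nonneg _)
    have h := hG.tendstoInMeasure_weighted (r := fun _ => 1) hN X Y W₀ hη hη0 hσ
      ((not_summable_iff_tendsto_nat_atTop_of_nonneg hησ).2 hdiv) (fun _ => zero_le_one)
      (fun θ hθ => .of_forall fun t => by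
        have := mul_nonneg hθ.le (hησ t)
        linarith) (by simpa using hσ) (by simpa using hη0)
    rw [tendstoInMeasure_iff_norm] at h ⊢
    simpa using h
  · set γ := min y (x / 2) - ε
    have hγy : γ ≤ y - ε := sub_le_sub_right (min_le_left _ _) _
    have hγx : γ ≤ x / 2 - ε := sub_le_sub_right (min_le_right _ _) _
    have hησ : ∀ t, 0 ≤ η t * σ t ^ 2 := fun t => mul_nonneg (hη t) (sq_nonneg _)
    have hlow := GaussAug.rpow_isBigO_mul hηx.2 hσy.2
    -- The margins are `y - γ ≥ ε` for `r σ²` and `x - 2 γ ≥ 2 ε` for `r² η`. The growth condition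
    -- uses `x + y < 1`, since `η σ²` dominates `t^(-(x+y))`.
    refine hG.tendstoInMeasure_weighted (r := fun t : ℕ => (t : ℝ) ^ γ) hN X Y W₀ hη
      (hηx.1.trans_tendsto (GaussAug.tendsto_rpow_neg_nat hx))
      (hσy.1.trans_tendsto (GaussAug.tendsto_rpow_neg_nat hy)) (fun hsum => ?_)
      (fun t => by positivity)
      (fun θ hθ => GaussAug.eventually_rpow_growth hησ hxy (by linarith) hlow hθ)
      ((GaussAug.rpow_mul_isBigO_rpow hσy.1 γ).trans_tendsto
        (GaussAug.tendsto_rpow_neg_nat (by linarith))) ?_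
    -- Summability of `η σ²` would force `∑ t^(-(x+y))` to converge, that is `x + y > 1`.
    · have := Real.summable_nat_rpow.1 (summable_of_isBigO_nat hsum hlow)
      linarith
    · refine ((GaussAug.rpow_mul_isBigO_rpow hηx.1 (2 * γ)).trans_tendsto
        (GaussAug.tendsto_rpow_neg_nat (by linarith))).congr fun t => ?_
      rw [mul_comm 2 γ, Real.rpow_mul (Nat.cast_nonneg t)]
      norm_num
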